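/- An *indexing category* $\mathbf G$ is a finite poset, regarded as a category with one arrow $i\to j$ for $i\le j$, in which any two objects $i,j$ have a minimal common ancestor (a greatest lower bound); $|\mathbf G|$ is its number of objects. A *finite probability space* is a set with a finitely supported probability measure; its *atoms* are the points of positive weight. A *reduction* is a measure-preserving map, up to equality on a set of full measure. A *$\mathbf G$-diagram* $\mathcal X=\{X_i;\chi_{ij}\}$ is a functor from $\mathbf G$ to finite probability spaces and reductions; reductions of diagrams are natural transformations; $\otimes$ and powers $\mathcal X^n$ are independent products. With $\mathrm{Ent}_*\mathcal X=(\mathrm{Ent}\,X_i)_{i\in\mathbf G}$ (Shannon entropies) put $$\mathbf k(\mathcal X,\mathcal Y)=\inf_{\mathcal X\leftarrow\mathcal Z\to\mathcal Y}\big(\|\mathrm{Ent}_*\mathcal Z-\mathrm{Ent}_*\mathcal X\|_1+\|\mathrm{Ent}_*\mathcal Z-\mathrm{Ent}_*\mathcal Y\|_1\big),\qquad \boldsymbol\kappa(\mathcal X,\mathcal Y)=\lim_{n\to\infty}\tfrac1n\,\mathbf k(\mathcal X^n,\mathcal Y^n).$$ A non-decreasing $\varphi:[1,\infty)\to[0,\infty)$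 is *admissible* if there is a constant $D$ with $8t\int_t^\infty\varphi(s)s^{-2}\,ds\le D\,\varphi(t)$ for all $t\ge1$. Fix a positive admissible function $\varphi$. A sequence $(\mathcal A(n))_{n\ge0}$ of diagrams is *quasi-linear* if for some constant $C$, $\boldsymbol\kappa(\mathcal A(n+m),\mathcal A(n)\otimes\mathcal A(m))\le C\varphi(n+m)$ whenever $n+m\ge1$. For sequences put $\boldsymbol\kappa(\bar{\mathcal A},\bar{\mathcal B})=\lim_{n\to\infty}\frac1n\mathbf k(\mathcal A(n),\mathcal B(n))$. A *tropical diagram* is a class of quasi-linear sequences, two sequences being equivalent if their $\boldsymbol\kappa$-distance is $0$. Let $U=X_\iota$ for an object $\iota$ of $\mathbf G$. For an atom $u$ of $U$, let $\mathcal X|u$ be the diagram with the same sets and maps as $\mathcal X$, whose distributions are the push-forwards of the distribution of the initial space of $\mathcal X$ conditioned on the fibre over $u$. The tropical diagram $[\mathcal X|U]=\int_U[\mathcal X|u]\,dp_U(u)$ is the class of the sequence $$n\mapsto\bigotimes_{u\in U}(\mathcal X|u)^{\lfloor n\,p_U(u)\rfloor},$$ the product being over the atoms of $U$. **Corollary.**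 Let $\mathbf G$ be an indexing category, $\mathcal X,\mathcal Y$ two $\mathbf G$-diagrams, $\iota\in\mathbf G$, $U:=X_\iota$, $V:=Y_\iota$. Then the above sequences are quasi-linear, so $[\mathcal X|U]$ and $[\mathcal Y|V]$ are tropical diagrams; the limits defining $\boldsymbol\kappa(\mathcal X,\mathcal Y)$ and $\boldsymbol\kappa([\mathcal X|U],[\mathcal Y|V])$ exist, the latter for all representatives of the two classes and independently of their choice; and $$\boldsymbol\kappa\big([\mathcal X|U],[\mathcal Y|V]\big)\le(2|\mathbf G|+1)\cdot\boldsymbol\kappa(\mathcal X,\mathcal Y).$$ -/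

import Mathlib

open Filter Topology

universe u v w

noncomputable section

/-- A finite probability space: a set with a probability distribution of finite support. -/
structure FinProbSpace : Type (u + 1) where
  carrier : Type u
  prob : PMF carrier
  finite_support : prob.support.Finite

namespace FinProbSpace

/-- The atoms of a probability space: the points of positive weight. -/
abbrev Atom (X : FinProbSpace.{u}) : Type u := {x : X.carrier // x ∈ X.prob.support}

instance (X : FinProbSpace.{u}) : Fintype X.Atom := X.finite_support.fintype

/-- The weight of an atom, as a real number. -/
def weight (X : FinProbSpace.{u}) (x : X.Atom) : ℝ := (X.prob x.1).toReal

/-- The Shannon entropy `-∑ p(x) log p(x)`, the sum being over the atoms. -/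
def entropy (X : FinProbSpace.{u}) : ℝ := ∑ x : X.Atom, Real.negMulLog (X.weight x)

/-- Measure-preserving maps between finite probability spaces. A reduction is the class of such
a map up to equality on a set of full measure. -/
def IsReduction (X Y : FinProbSpace.{u}) (f : X.carrier → Y.carrier) : Prop :=
  X.prob.map f = Y.prob

/-- The product distribution of two distributions. -/
def prodPMF {α β : Type u} (p : PMF α) (q : PMF β) : PMF (α × β) :=
  p.bind fun x => q.map fun y => (x, y)

theorem mem_support_prodPMF {α β : Type u} {p : PMF α} {q : PMF β} {z : α × β}
    (hz : z ∈ (prodPMF p q).support) : z.1 ∈ p.support ∧ z.2 ∈ q.support := by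
  rw [prodPMF, PMF.mem_support_bind_iff] at hz
  obtain ⟨x, hx, hz⟩ := hz
  rw [PMF.mem_support_map_iff] at hz
  obtain ⟨y, hy, rfl⟩ := hz
  exact ⟨hx, hy⟩

theorem prodPMF_map {α β α' β' : Type u} (p : PMF α) (q : PMF β) (f : α → α') (g : β → β') :
    (prodPMF p q).map (Prod.map f g) = prodPMF (p.map f) (q.map g) := by
  simp only [prodPMF, PMF.map_bind, PMF.bind_map, PMF.map_comp]
  rfl

/-- The independent product of two probability spaces. -/
def tensor (X Y : FinProbSpace.{u}) : FinProbSpace.{u} where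
  carrier := X.carrier × Y.carrier
  prob := prodPMF X.prob Y.prob
  finite_support :=
    (X.finite_support.prod Y.finite_support).subset fun _ h => mem_support_prodPMF h

theorem tensor_isReduction {X Y X' Y' : FinProbSpace.{u}} {f : X.carrier → X'.carrier}
    {g : Y.carrier → Y'.carrier} (hf : IsReduction X X' f) (hg : IsReduction Y Y' g) :
    IsReduction (X.tensor Y) (X'.tensor Y') (Prod.map f g) := by
  have h := prodPMF_map X.prob Y.prob f g
  rw [hf, hg] at h
  exact h

theorem tsum_pi_prod {K : Type w} [Fintype K] {α : K → Type u} (g : ∀ k, α k → ENNReal)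
    (hg : ∀ k, (Function.support (g k)).Finite) :
    ∑' x : ∀ k, α k, ∏ k, g k (x k) = ∏ k, ∑' a, g k a := by
  classical
  have h1 : ∀ k, ∑' a, g k a = ∑ a ∈ (hg k).toFinset, g k a := fun k =>
    tsum_eq_sum (fun a ha => by simpa using ha)
  rw [Finset.prod_congr rfl (fun k _ => h1 k), Finset.prod_univ_sum]
  refine tsum_eq_sum (fun x hx => ?_)
  simp only [Fintype.mem_piFinset, Set.Finite.mem_toFinset, Function.mem_support, not_forall,
    not_not] at hx
  obtain ⟨k, hk⟩ := hx
  exact Finset.prod_eq_zero (Finset.mem_univ k) hk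

/-- The product distribution of a finite family of finitely supported distributions. -/
def piPMF {K : Type w} [Fintype K] {α : K → Type u} (p : ∀ k, PMF (α k))
    (hp : ∀ k, (p k).support.Finite) : PMF (∀ k, α k) :=
  ⟨fun x => ∏ k, p k (x k), by
    have h := tsum_pi_prod (fun k => (p k : α k → ENNReal)) hp
    simp only [PMF.tsum_coe, Finset.prod_const_one] at h
    exact h ▸ ENNReal.summable.hasSum⟩

theorem piPMF_apply {K : Type w} [Fintype K] {α : K → Type u} (p : ∀ k, PMF (α k))
    (hp : ∀ k, (p k).support.Finite) (x : ∀ k, α k) : piPMF p hp x = ∏ k, p k (x k) := rfl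

theorem mem_support_piPMF {K : Type w} [Fintype K] {α : K → Type u} {p : ∀ k, PMF (α k)}
    {hp : ∀ k, (p k).support.Finite} {x : ∀ k, α k} (hx : x ∈ (piPMF p hp).support) (k : K) :
    x k ∈ (p k).support := by
  rw [PMF.mem_support_iff, piPMF_apply] at hx
  rw [PMF.mem_support_iff]
  exact fun h0 => hx (Finset.prod_eq_zero (Finset.mem_univ k) h0)

theorem piPMF_map {K : Type w} [Fintype K] {α β : K → Type u} (p : ∀ k, PMF (α k))
    (hp : ∀ k, (p k).support.Finite) (q : ∀ k, PMF (β k)) (hq : ∀ k, (q k).support.Finite)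
    (f : ∀ k, α k → β k) (hf : ∀ k, (p k).map (f k) = q k) :
    (piPMF p hp).map (fun x k => f k (x k)) = piPMF q hq := by
  classical
  refine PMF.ext fun y => ?_
  have hY : ∀ k, q k (y k) = ∑' a, if y k = f k a then p k a else 0 := fun k => by
    rw [← hf k, PMF.map_apply]
  rw [PMF.map_apply, piPMF_apply, Finset.prod_congr rfl (fun k _ => hY k),
    ← tsum_pi_prod (fun k a => if y k = f k a then p k a else 0)]
  · refine tsum_congr fun x => ?_
    rw [piPMF_apply]
    by_cases h : y = fun k => f k (x k)
    · rw [if_pos h]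
      exact Finset.prod_congr rfl fun k _ => by rw [if_pos (congrFun h k)]
    · rw [if_neg h]
      obtain ⟨k, hk⟩ : ∃ k, y k ≠ f k (x k) := by
        by_contra hc
        push Not at hc
        exact h (funext hc)
      exact (Finset.prod_eq_zero (Finset.mem_univ k) (if_neg hk)).symm
  · intro k
    refine (hp k).subset fun a ha => ?_
    simp only [Function.mem_support, ne_eq, ite_eq_right_iff, Classical.not_imp] at ha
    exact ha.2

/-- The independent product of a finite family of probability spaces. -/
def tensorFamily {K : Type w} [Fintype K] (X : K → FinProbSpace.{u}) :
    FinProbSpace.{max w u} where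
  carrier := ∀ k, (X k).carrier
  prob := piPMF (fun k => (X k).prob) fun k => (X k).finite_support
  finite_support :=
    (Set.Finite.pi' fun k => (X k).finite_support).subset fun _ hx k => mem_support_piPMF hx k

theorem mem_support_tensorFamily {K : Type w} [Fintype K] {X : K → FinProbSpace.{u}}
    {x : ∀ k, (X k).carrier} (hx : x ∈ (tensorFamily X).prob.support) (k : K) :
    x k ∈ (X k).prob.support :=
  mem_support_piPMF (hp := fun k => (X k).finite_support) hx k

theorem tensorFamily_isReduction {K : Type w} [Fintype K] {X Y : K → FinProbSpace.{u}}
    {f : ∀ k, (X k).carrier → (Y k).carrier} (hf : ∀ k, IsReduction (X k) (Y k) (f k)) :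
    IsReduction (tensorFamily X) (tensorFamily Y) (fun x k => f k (x k)) :=
  piPMF_map _ (fun k => (X k).finite_support) _ (fun k => (Y k).finite_support) f hf

end FinProbSpace

open FinProbSpace

/-- A commutative `G`-diagram of finite probability spaces, that is, a functor from the poset `G`
(with one arrow `i → j` for `i ≤ j`) to the category of finite probability spaces and reductions.
Each reduction is given by a measure-preserving representative, so that functoriality is required
on the atoms only. -/
structure ProbDiagram (G : Type v) [PartialOrder G] : Type (max v (u + 1)) where
  obj : G → FinProbSpace.{u}
  map : ∀ {i j : G}, i ≤ j → (obj i).carrier → (obj j).carrier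
  map_isReduction : ∀ {i j : G} (h : i ≤ j), IsReduction (obj i) (obj j) (map h)
  map_refl : ∀ (i : G), ∀ x ∈ (obj i).prob.support, map (le_refl i) x = x
  map_trans : ∀ {i j k : G} (hij : i ≤ j) (hjk : j ≤ k), ∀ x ∈ (obj i).prob.support,
    map hjk (map hij x) = map (hij.trans hjk) x

namespace ProbDiagram

section Basic

variable {G : Type v} [PartialOrder G]

/-- A reduction of `G`-diagrams, that is, a natural transformation: a family of reductions
commuting with the structure maps (on the atoms). -/
structure Reduction (X Y : ProbDiagram.{u} G) where
  app : ∀ i : G, (X.obj i).carrier → (Y.obj i).carrier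
  app_isReduction : ∀ i : G, IsReduction (X.obj i) (Y.obj i) (app i)
  naturality : ∀ {i j : G} (h : i ≤ j), ∀ x ∈ (X.obj i).prob.support,
    app j (X.map h x) = Y.map h (app i x)

/-- A fan of diagrams `X ← Z → Y`. -/
structure Fan (X Y : ProbDiagram.{u} G) where
  apex : ProbDiagram.{u} G
  left : Reduction apex X
  right : Reduction apex Y

/-- The tensor product of two diagrams. -/
def tensor (X Y : ProbDiagram.{u} G) : ProbDiagram.{u} G where
  obj i := (X.obj i).tensor (Y.obj i)
  map h := Prod.map (X.map h) (Y.map h)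
  map_isReduction h := tensor_isReduction (X.map_isReduction h) (Y.map_isReduction h)
  map_refl i _ hx := Prod.ext (X.map_refl i _ (mem_support_prodPMF hx).1)
    (Y.map_refl i _ (mem_support_prodPMF hx).2)
  map_trans hij hjk _ hx := Prod.ext (X.map_trans hij hjk _ (mem_support_prodPMF hx).1)
    (Y.map_trans hij hjk _ (mem_support_prodPMF hx).2)

/-- The tensor product of a finite family of diagrams. -/
def tensorFamily {K : Type w} [Fintype K] (X : K → ProbDiagram.{u} G) :
    ProbDiagram.{max w u} G where
  obj i := FinProbSpace.tensorFamily fun k => (X k).obj i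
  map h := fun x k => (X k).map h (x k)
  map_isReduction h := tensorFamily_isReduction fun k => (X k).map_isReduction h
  map_refl i _ hx := funext fun k => (X k).map_refl i _ (mem_support_tensorFamily hx k)
  map_trans hij hjk _ hx :=
    funext fun k => (X k).map_trans hij hjk _ (mem_support_tensorFamily hx k)

/-- The tensor power `Xⁿ`. -/
def pow (X : ProbDiagram.{u} G) (n : ℕ) : ProbDiagram.{u} G :=
  tensorFamily.{u, v, 0} fun _ : Fin n => X

end Basic

section Distance

variable {G : Type v} [PartialOrder G] [Fintype G]

/-- The entropy distance `‖Ent Z - Ent X‖₁ + ‖Ent Z - Ent Y‖₁` of a fan `X ← Z → Y`. -/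
def kd {X Y : ProbDiagram.{u} G} (K : Fan X Y) : ℝ :=
  ∑ i, |(K.apex.obj i).entropy - (X.obj i).entropy| +
    ∑ i, |(K.apex.obj i).entropy - (Y.obj i).entropy|

/-- The intrinsic entropy distance: the infimum of the entropy distances of all fans. -/
def ikd (X Y : ProbDiagram.{u} G) : ℝ := ⨅ K : Fan X Y, kd K

/-- The asymptotic entropy distance `lim (1/n) ikd(A(n), B(n))` of two sequences of diagrams. -/
def aikdSeq (A B : ℕ → ProbDiagram.{u} G) : ℝ :=
  limUnder atTop fun n : ℕ => ikd (A n) (B n) / n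

/-- The linear sequence `n ↦ Xⁿ` generated by a diagram. -/
def linSeq (X : ProbDiagram.{u} G) : ℕ → ProbDiagram.{u} G := fun n => X.pow n

/-- The asymptotic entropy distance `lim (1/n) ikd(Xⁿ, Yⁿ)` of two diagrams. -/
def aikd (X Y : ProbDiagram.{u} G) : ℝ := aikdSeq X.linSeq Y.linSeq

end Distance

end ProbDiagram

/-- Admissible functions on `[1, ∞)`; values of `φ` outside `[1, ∞)` play no role. -/
structure IsAdmissible (φ : ℝ → ℝ) : Prop where
  nonneg : ∀ t, 1 ≤ t → 0 ≤ φ t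
  mono : MonotoneOn φ (Set.Ici 1)
  integrable : ∀ t, 1 ≤ t → MeasureTheory.IntegrableOn (fun s => φ s / s ^ 2) (Set.Ioi t)
  bound : ∃ D : ℝ, ∀ t, 1 ≤ t → 8 * t * ∫ s in Set.Ioi t, φ s / s ^ 2 ≤ D * φ t

namespace ProbDiagram

section Tropical

variable {G : Type v} [PartialOrder G] [Fintype G]

/-- Quasi-linear sequences of diagrams, with defect bounded by (a multiple of) `φ`. -/
def IsQuasiLinear (φ : ℝ → ℝ) (A : ℕ → ProbDiagram.{u} G) : Prop :=
  ∃ C : ℝ, ∀ n m : ℕ, 1 ≤ n + m →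
    aikd (A (n + m)) ((A n).tensor (A m)) ≤ C * φ ((n + m : ℕ) : ℝ)

/-- Asymptotic equivalence of sequences: `(1/n) ikd(A(n), B(n))` tends to zero. -/
def AsympEquiv (A B : ℕ → ProbDiagram.{u} G) : Prop :=
  Tendsto (fun n : ℕ => ikd (A n) (B n) / n) atTop (𝓝 0)

/-- The tropical diagram represented by a quasi-linear sequence `A`: the class of all
quasi-linear sequences that are asymptotically equivalent to `A`. -/
def tropicalClass (φ : ℝ → ℝ) (A : ℕ → ProbDiagram.{u} G) : Set (ℕ → ProbDiagram.{u} G) :=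
  {B | IsQuasiLinear φ B ∧ AsympEquiv A B}

/-- The action of nonnegative reals on sequences. -/
def scaleSeq (c : ℝ) (A : ℕ → ProbDiagram.{u} G) : ℕ → ProbDiagram.{u} G :=
  fun n => A ⌊c * n⌋₊

/-- The sum of a finite family of tropical diagrams, on representing sequences: the termwise
tensor product. -/
def sumSeq {K : Type u} [Fintype K] (A : K → ℕ → ProbDiagram.{u} G) : ℕ → ProbDiagram.{u} G :=
  fun n => tensorFamily.{u, v, u} fun k => A k n

end Tropical

section Conditioning

variable {G : Type v} [SemilatticeInf G] [Fintype G]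

/-- The initial object of the indexing category (the argument `ι` only serves to show that `G` is
nonempty). -/
def initialObj (ι : G) : G := Finset.univ.inf' ⟨ι, Finset.mem_univ ι⟩ id

theorem initialObj_le (ι i : G) : initialObj ι ≤ i := Finset.inf'_le id (Finset.mem_univ i)

theorem exists_lift_atom (X : ProbDiagram.{u} G) (ι : G) (a : (X.obj ι).Atom) :
    ∃ x ∈ X.map (initialObj_le ι ι) ⁻¹' {a.1}, x ∈ (X.obj (initialObj ι)).prob.support := by
  obtain ⟨a, ha⟩ := a
  have h := ha
  rw [← X.map_isReduction (initialObj_le ι ι), PMF.mem_support_map_iff] at h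
  obtain ⟨x, hx, hxa⟩ := h
  exact ⟨x, hxa, hx⟩

/-- The distribution on the initial space conditioned on the atom `a` of the space `X_ι`, that is,
restricted to the fibre over `a` and normalized. -/
def condInitial (X : ProbDiagram.{u} G) (ι : G) (a : (X.obj ι).Atom) :
    PMF (X.obj (initialObj ι)).carrier :=
  (X.obj (initialObj ι)).prob.filter (X.map (initialObj_le ι ι) ⁻¹' {a.1})
    (X.exists_lift_atom ι a)

theorem condInitial_support (X : ProbDiagram.{u} G) (ι : G) (a : (X.obj ι).Atom)
    {x : (X.obj (initialObj ι)).carrier} (hx : x ∈ (X.condInitial ι a).support) :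
    x ∈ (X.obj (initialObj ι)).prob.support :=
  ((PMF.mem_support_filter_iff _).1 hx).2

theorem cond_support (X : ProbDiagram.{u} G) (ι : G) (a : (X.obj ι).Atom) (i : G)
    {x : (X.obj i).carrier}
    (hx : x ∈ ((X.condInitial ι a).map (X.map (initialObj_le ι i))).support) :
    x ∈ (X.obj i).prob.support := by
  rw [PMF.mem_support_map_iff] at hx
  obtain ⟨y, hy, rfl⟩ := hx
  rw [← X.map_isReduction (initialObj_le ι i), PMF.mem_support_map_iff]
  exact ⟨y, X.condInitial_support ι a hy, rfl⟩

/-- The conditioned diagram `X | a`: same sets and maps, with the distributions pushed forward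
from the conditioned distribution on the initial space. -/
def cond (X : ProbDiagram.{u} G) (ι : G) (a : (X.obj ι).Atom) : ProbDiagram.{u} G where
  obj i :=
    { carrier := (X.obj i).carrier
      prob := (X.condInitial ι a).map (X.map (initialObj_le ι i))
      finite_support := (X.obj i).finite_support.subset fun _ hx => X.cond_support ι a i hx }
  map h := X.map h
  map_isReduction {i j} h := by
    have hc : ∀ x ∈ (X.condInitial ι a).support,
        (X.map h ∘ X.map (initialObj_le ι i)) x = X.map (initialObj_le ι j) x := fun x hx =>
      X.map_trans (initialObj_le ι i) h x (X.condInitial_support ι a hx)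
    change ((X.condInitial ι a).map (X.map (initialObj_le ι i))).map (X.map h) =
      (X.condInitial ι a).map (X.map (initialObj_le ι j))
    rw [PMF.map_comp]
    refine PMF.ext fun y => ?_
    rw [PMF.map_apply, PMF.map_apply]
    refine tsum_congr fun x => ?_
    by_cases hx : x ∈ (X.condInitial ι a).support
    · rw [hc x hx]
    · rw [PMF.apply_eq_zero_iff _ _ |>.2 hx, ite_self, ite_self]
  map_refl i x hx := X.map_refl i x (X.cond_support ι a i hx)
  map_trans hij hjk x hx := X.map_trans hij hjk x (X.cond_support ι a _ hx)

/-- The sequence representing `[X | U] = ∫_U [X | a] dp(a)`, where `U = X_ι`: the convex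
combination, with the weights of the atoms of `U`, of the linear sequences generated by the
conditioned diagrams. Its `n`-th term is the tensor product over the atoms `a` of
`(X | a) ^ ⌊p(a) n⌋`. -/
def condSeq (X : ProbDiagram.{u} G) (ι : G) : ℕ → ProbDiagram.{u} G :=
  sumSeq fun a : (X.obj ι).Atom => scaleSeq ((X.obj ι).weight a) (X.cond ι a).linSeq

/-- The tropical diagram `[X | U]`, where `U = X_ι`. -/
def condTropical (φ : ℝ → ℝ) (X : ProbDiagram.{u} G) (ι : G) : Set (ℕ → ProbDiagram.{u} G) :=
  tropicalClass φ (X.condSeq ι)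

end Conditioning

end ProbDiagram

end

-- A diagram is replaced by the atoms of its initial space together with the partitions into fibres
-- of its maps (`PartSpace`). A fan then becomes a coupling of two finite probability spaces, and
-- `ikd` becomes the infimum over couplings K of ∑ᵢ (2 H(Xᵢ,Yᵢ) - H(Xᵢ) - H(Yᵢ)) (`ikd_eq_dist`).
-- Everything except the translation at the end concerns this distance.
--
-- The main tool is slicing (`dist_le_sum_slices`). If X is a mixture of slices X_b with weights P,
-- couple each slice with Y and mix the couplings. Recording b costs at most H(P) in each joint
-- entropy, while concavity bounds H(Xᵢ) below by the averages over the slices, so dist(X,Y) ≤ ∑ P_b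
-- dist(X_b,Y) + 2|G| H(P). For the k-th power of a mixture, the slices are products of components
-- whose multiplicities deviate from kP_b by O(√k) on average. Hence the power is within 2|G| k H(P)
-- + O(√k) of the product of the components with their expected multiplicities
-- (`dist_pi_mixture_powers_le`).
--
-- Fix a coupling K of X and Y, and let Q be the law of the pair (U,V). Each X|a is a mixture of the
-- X-marginals of K given (U,V) = (a,b), so passing from the conditioned product of X to the product
-- of these finer slices costs 2|G| m H(V|U) + O(√m); for Y it costs 2|G| m H(U|V) + O(√m). The
-- entropies add up to 2H(U,V) - H(U) - H(V), the ι-th summand of the cost of K, so both moves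
-- together cost at most 2|G| m cost(K) + O(√m). The two families of finer slices are coupled by the
-- conditioned couplings, whose average cost is at most cost(K) by submodularity
-- (`sum_mul_cost_cond_le`). This gives the factor 2|G| + 1 in `exists_dist_powers_cond_le`.
--
-- To replace the one-shot distance by the asymptotic one, apply this to X^N and Y^N. The m-th
-- conditioned term of X^N is within a bounded distance of the Nm-th conditioned term of X
-- (`exists_dist_powers_scale_le`). Dividing by m and then by N gives the inequality. The limits
-- exist by Fekete's lemma, because rounding multiplicities changes the products by a bounded amount
-- only; the same remark gives quasi-linearity.

universe w₁ w₂ w₃ w₄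

noncomputable section

/-! ### Entropy of partitions -/

open Classical in
/-- The weight of the class of `ω`. -/
def classWeight {Ω : Type*} [Fintype Ω] (p : Ω → ℝ) (r : Setoid Ω) (ω : Ω) : ℝ :=
  ∑ ω', if r ω' ω then p ω' else 0

/-- The Shannon entropy of the partition `r` with respect to the weights `p`. -/
def partEntropy {Ω : Type*} [Fintype Ω] (p : Ω → ℝ) (r : Setoid Ω) : ℝ :=
  -∑ ω, p ω * Real.log (classWeight p r ω)

open Classical in
/-- The push-forward of weights. -/
def pushWeight {Ω Ω' : Type*} [Fintype Ω] (g : Ω → Ω') (p : Ω → ℝ) (y : Ω') : ℝ :=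
  ∑ x, if g x = y then p x else 0

section PartEntropy

variable {Ω Ω' Ω'' : Type*} [Fintype Ω]

theorem pushWeight_nonneg {p : Ω → ℝ} (hp : ∀ ω, 0 ≤ p ω) (g : Ω → Ω') (y : Ω') :
    0 ≤ pushWeight g p y :=
  Finset.sum_nonneg fun x _ => by split_ifs <;> simp [hp]

theorem sum_pushWeight_mul [Fintype Ω'] (p : Ω → ℝ) (g : Ω → Ω') (F : Ω' → ℝ) :
    ∑ y, pushWeight g p y * F y = ∑ x, p x * F (g x) := by
  classical
  simp only [pushWeight, Finset.sum_mul, ite_mul, zero_mul]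
  rw [Finset.sum_comm]
  simp

theorem sum_pushWeight [Fintype Ω'] (p : Ω → ℝ) (g : Ω → Ω') : ∑ y, pushWeight g p y = ∑ x, p x := by
  simpa using sum_pushWeight_mul p g fun _ => 1

theorem pushWeight_comp [Fintype Ω'] (p : Ω → ℝ) (g : Ω → Ω') (h : Ω' → Ω'') :
    pushWeight h (pushWeight g p) = pushWeight (h ∘ g) p := by
  classical
  funext z
  have := sum_pushWeight_mul p g fun y => if h y = z then 1 else 0
  simpa [pushWeight] using this

theorem pushWeight_id (p : Ω → ℝ) : pushWeight id p = p := by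
  classical
  funext z
  simp [pushWeight]

theorem pushWeight_apply_equiv (p : Ω → ℝ) (e : Ω ≃ Ω') (x : Ω) :
    pushWeight e p (e x) = p x := by
  classical
  simp [pushWeight]

theorem pushWeight_eq_zero {p : Ω → ℝ} (hp : ∀ ω, 0 ≤ p ω) {g : Ω → Ω'} {x : Ω}
    (h : pushWeight g p (g x) = 0) : p x = 0 := by
  classical
  rw [pushWeight, Finset.sum_eq_zero_iff_of_nonneg fun x _ => by split_ifs <;> simp [hp]] at h
  simpa using h x (Finset.mem_univ x)

theorem classWeight_nonneg {p : Ω → ℝ} (hp : ∀ ω, 0 ≤ p ω) (r : Setoid Ω) (ω : Ω) :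
    0 ≤ classWeight p r ω :=
  Finset.sum_nonneg fun x _ => by split_ifs <;> simp [hp]

theorem classWeight_mono {p : Ω → ℝ} (hp : ∀ ω, 0 ≤ p ω) {r s : Setoid Ω} (h : r ≤ s) (ω : Ω) :
    classWeight p r ω ≤ classWeight p s ω :=
  Finset.sum_le_sum fun x _ => by
    by_cases hx : r x ω
    · rw [if_pos hx, if_pos (h hx)]
    · rw [if_neg hx]
      split_ifs <;> simp [hp]

theorem le_classWeight {p : Ω → ℝ} (hp : ∀ ω, 0 ≤ p ω) (r : Setoid Ω) (ω : Ω) :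
    p ω ≤ classWeight p r ω := by
  classical
  have := Finset.single_le_sum (f := fun ω' => if r ω' ω then p ω' else 0)
    (fun x _ => by split_ifs <;> simp [hp]) (Finset.mem_univ ω)
  simpa [classWeight, r.refl] using this

theorem classWeight_congr (p : Ω → ℝ) (r : Setoid Ω) {ω ω' : Ω} (h : r ω ω') :
    classWeight p r ω = classWeight p r ω' := by
  refine Finset.sum_congr rfl fun x _ => ?_
  have : r x ω ↔ r x ω' := ⟨fun hx => r.trans hx h, fun hx => r.trans hx (r.symm h)⟩
  by_cases hx : r x ω
  · rw [if_pos hx, if_pos (this.1 hx)]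
  · rw [if_neg hx, if_neg fun h => hx (this.2 h)]

theorem classWeight_top (p : Ω → ℝ) (ω : Ω) : classWeight p ⊤ ω = ∑ x, p x := by
  simp [classWeight, Setoid.top_def]

theorem classWeight_bot (p : Ω → ℝ) (ω : Ω) : classWeight p ⊥ ω = p ω := by
  classical
  simp [classWeight]

theorem classWeight_pushWeight [Fintype Ω'] (p : Ω → ℝ) (g : Ω → Ω') (r : Setoid Ω') (ω : Ω) :
    classWeight (pushWeight g p) r (g ω) = classWeight p (r.comap g) ω := by
  classical
  have := sum_pushWeight_mul p g fun y => if r y (g ω) then 1 else 0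
  simpa [classWeight, Setoid.comap_rel] using this

theorem partEntropy_pushWeight [Fintype Ω'] (p : Ω → ℝ) (g : Ω → Ω') (r : Setoid Ω') :
    partEntropy (pushWeight g p) r = partEntropy p (r.comap g) := by
  rw [partEntropy, sum_pushWeight_mul]
  simp only [classWeight_pushWeight, partEntropy]

theorem partEntropy_top {p : Ω → ℝ} (h1 : ∑ x, p x = 1) : partEntropy p ⊤ = 0 := by
  simp [partEntropy, classWeight_top, h1]

theorem partEntropy_mono {p : Ω → ℝ} (hp : ∀ ω, 0 ≤ p ω) {r s : Setoid Ω} (h : r ≤ s) :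
    partEntropy p s ≤ partEntropy p r := by
  refine neg_le_neg (Finset.sum_le_sum fun ω _ => ?_)
  rcases (hp ω).eq_or_lt with h0 | h0
  · simp [← h0]
  · exact mul_le_mul_of_nonneg_left (Real.log_le_log (h0.trans_le (le_classWeight hp r ω))
      (classWeight_mono hp h ω)) (hp ω)

theorem partEntropy_nonneg {p : Ω → ℝ} (hp : ∀ ω, 0 ≤ p ω) (h1 : ∑ x, p x = 1) (r : Setoid Ω) :
    0 ≤ partEntropy p r :=
  (partEntropy_top h1).symm.le.trans (partEntropy_mono hp le_top)

/-- Expand the numerator as a double sum over α and β, and sum over ω last. The points ω compatible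
with a given pair lie in a single class of `r ⊓ s ⊓ t`, whose weight cancels. -/
theorem sum_mul_classWeight_div_le_one {p : Ω → ℝ} (hp : ∀ ω, 0 ≤ p ω) (h1 : ∑ x, p x = 1)
    (r s t : Setoid Ω) :
    ∑ ω, p ω * (classWeight p (r ⊓ t) ω * classWeight p (s ⊓ t) ω /
      (classWeight p (r ⊓ s ⊓ t) ω * classWeight p t ω)) ≤ 1 := by
  classical
  have hinner : ∀ α β, (∑ ω, if (r ⊓ t) α ω ∧ (s ⊓ t) β ω then
      p ω / (classWeight p (r ⊓ s ⊓ t) ω * classWeight p t ω) else 0) ≤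
      if t β α then 1 / classWeight p t α else 0 := by
    intro α β
    by_cases hex : ∃ ω, (r ⊓ t) α ω ∧ (s ⊓ t) β ω
    · obtain ⟨ω₀, hα, hβ⟩ := hex
      have ht : t β α := t.trans hβ.2 (t.symm hα.2)
      rw [if_pos ht]
      -- Once one compatible point ω₀ exists, the compatible points are exactly its class.
      have hiff : ∀ ω, ((r ⊓ t) α ω ∧ (s ⊓ t) β ω) ↔ (r ⊓ s ⊓ t) ω ω₀ := fun ω =>
        ⟨fun h => ⟨⟨r.trans (r.symm h.1.1) hα.1, s.trans (s.symm h.2.1) hβ.1⟩,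
          t.trans (t.symm h.1.2) hα.2⟩,
          fun h => ⟨⟨r.trans hα.1 (r.symm h.1.1), t.trans hα.2 (t.symm h.2)⟩,
            ⟨s.trans hβ.1 (s.symm h.1.2), t.trans hβ.2 (t.symm h.2)⟩⟩⟩
      have heq : ∀ ω, (if (r ⊓ t) α ω ∧ (s ⊓ t) β ω then
          p ω / (classWeight p (r ⊓ s ⊓ t) ω * classWeight p t ω) else 0) =
          (if (r ⊓ s ⊓ t) ω ω₀ then p ω else 0) *
            (1 / (classWeight p (r ⊓ s ⊓ t) ω₀ * classWeight p t α)) := by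
        intro ω
        rw [if_congr (hiff ω) rfl rfl]
        split_ifs with h
        · rw [classWeight_congr p _ h,
            classWeight_congr p t (t.trans h.2 (t.symm hα.2))]
          ring
        · ring
      rw [Finset.sum_congr rfl fun ω _ => heq ω, ← Finset.sum_mul]
      change classWeight p (r ⊓ s ⊓ t) ω₀ * _ ≤ _
      rw [one_div, mul_inv, ← mul_assoc, one_div]
      -- Since 0⁻¹ = 0, the bound x * x⁻¹ ≤ 1 also covers classes of weight zero.
      exact mul_le_of_le_one_left (inv_nonneg.2 (classWeight_nonneg hp t α)) (mul_inv_le_one)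
    · push Not at hex
      rw [Finset.sum_eq_zero fun ω _ => if_neg fun h => hex ω h.1 h.2]
      split_ifs
      · exact one_div_nonneg.2 (classWeight_nonneg hp t α)
      · exact le_rfl
  calc _ = ∑ ω, ∑ α, ∑ β, p α * p β * (if (r ⊓ t) α ω ∧ (s ⊓ t) β ω then
      p ω / (classWeight p (r ⊓ s ⊓ t) ω * classWeight p t ω) else 0) := by
        refine Finset.sum_congr rfl fun ω _ => ?_
        have h2 : classWeight p (r ⊓ t) ω * classWeight p (s ⊓ t) ω =
            ∑ α, ∑ β, if (r ⊓ t) α ω ∧ (s ⊓ t) β ω then p α * p β else 0 := by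
          rw [classWeight, classWeight, Finset.sum_mul_sum]
          refine Finset.sum_congr rfl fun α _ => Finset.sum_congr rfl fun β _ => ?_
          by_cases ha : (r ⊓ t) α ω <;> by_cases hb : (s ⊓ t) β ω <;> simp [ha, hb]
        rw [h2, mul_div_assoc', mul_comm (p ω), mul_div_assoc, Finset.sum_mul]
        refine Finset.sum_congr rfl fun α _ => ?_
        rw [Finset.sum_mul]
        refine Finset.sum_congr rfl fun β _ => ?_
        split_ifs <;> ring
    _ = ∑ α, ∑ β, p α * p β * ∑ ω, (if (r ⊓ t) α ω ∧ (s ⊓ t) β ω then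
      p ω / (classWeight p (r ⊓ s ⊓ t) ω * classWeight p t ω) else 0) := by
        rw [Finset.sum_comm]
        refine Finset.sum_congr rfl fun α _ => ?_
        rw [Finset.sum_comm]
        exact Finset.sum_congr rfl fun β _ => (Finset.mul_sum _ _ _).symm
    _ ≤ ∑ α, ∑ β, p α * p β * (if t β α then 1 / classWeight p t α else 0) :=
        Finset.sum_le_sum fun α _ => Finset.sum_le_sum fun β _ =>
          mul_le_mul_of_nonneg_left (hinner α β) (mul_nonneg (hp α) (hp β))
    _ = ∑ α, p α * (classWeight p t α * (classWeight p t α)⁻¹) := by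
        refine Finset.sum_congr rfl fun α _ => ?_
        conv_rhs => rw [classWeight, Finset.sum_mul, Finset.mul_sum]
        refine Finset.sum_congr rfl fun β _ => ?_
        change _ = p α * ((if t β α then p β else 0) * (classWeight p t α)⁻¹)
        split_ifs <;> ring
    _ ≤ ∑ α, p α := Finset.sum_le_sum fun α _ =>
        mul_le_of_le_one_right (hp α) mul_inv_le_one
    _ = 1 := h1

/-- Nonnegativity of the conditional mutual information of r and s given t: apply log x ≤ x - 1 to
the ratio of `sum_mul_classWeight_div_le_one` and average. -/
theorem partEntropy_submodular {p : Ω → ℝ} (hp : ∀ ω, 0 ≤ p ω) (h1 : ∑ x, p x = 1)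
    (r s t : Setoid Ω) :
    partEntropy p (r ⊓ s ⊓ t) + partEntropy p t ≤
      partEntropy p (r ⊓ t) + partEntropy p (s ⊓ t) := by
  have key : ∑ ω, p ω * (Real.log (classWeight p (r ⊓ t) ω) + Real.log (classWeight p (s ⊓ t) ω)
      - Real.log (classWeight p (r ⊓ s ⊓ t) ω) - Real.log (classWeight p t ω)) ≤ 0 := by
    calc _ ≤ ∑ ω, (p ω * (classWeight p (r ⊓ t) ω * classWeight p (s ⊓ t) ω /
          (classWeight p (r ⊓ s ⊓ t) ω * classWeight p t ω)) - p ω) := by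
          refine Finset.sum_le_sum fun ω _ => ?_
          rcases (hp ω).eq_or_lt with h0 | h0
          · simp [← h0]
          · have hpos : ∀ r : Setoid Ω, 0 < classWeight p r ω := fun r =>
              h0.trans_le (le_classWeight hp r ω)
            have ha := hpos (r ⊓ t)
            have hb := hpos (s ⊓ t)
            have hc := hpos (r ⊓ s ⊓ t)
            have hd := hpos t
            have := Real.log_le_sub_one_of_pos (div_pos (mul_pos ha hb) (mul_pos hc hd))
            rw [Real.log_div (mul_pos ha hb).ne' (mul_pos hc hd).ne', Real.log_mul ha.ne' hb.ne',
              Real.log_mul hc.ne' hd.ne'] at this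
            have h2 := mul_le_mul_of_nonneg_left this (hp ω)
            linarith
      _ ≤ 0 := by
          rw [Finset.sum_sub_distrib, h1]
          linarith [sum_mul_classWeight_div_le_one hp h1 r s t]
  simp only [mul_sub, mul_add, Finset.sum_sub_distrib, Finset.sum_add_distrib] at key
  simp only [partEntropy]
  linarith

theorem partEntropy_inf_le {p : Ω → ℝ} (hp : ∀ ω, 0 ≤ p ω) (h1 : ∑ x, p x = 1)
    (r s : Setoid Ω) : partEntropy p (r ⊓ s) ≤ partEntropy p r + partEntropy p s := by
  have := partEntropy_submodular hp h1 r s ⊤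
  simp only [inf_top_eq, partEntropy_top h1] at this
  linarith

/-- The chain rule for a mixture. -/
theorem partEntropy_mixture {B : Type*} [Fintype B] {P : B → ℝ} (hP : ∀ b, 0 ≤ P b)
    {q : B → Ω → ℝ} (hq : ∀ b ω, 0 ≤ q b ω) (hq1 : ∀ b, ∑ ω, q b ω = 1) (r : Setoid Ω) :
    partEntropy (fun z : B × Ω => P z.1 * q z.1 z.2)
      ((⊥ : Setoid B).comap Prod.fst ⊓ r.comap Prod.snd) =
      partEntropy P ⊥ + ∑ b, P b * partEntropy (q b) r := by
  classical
  have hcw : ∀ b ω, classWeight (fun z : B × Ω => P z.1 * q z.1 z.2)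
      ((⊥ : Setoid B).comap Prod.fst ⊓ r.comap Prod.snd) (b, ω) =
      P b * classWeight (q b) r ω := by
    intro b ω
    have : ∀ z : B × Ω, ((⊥ : Setoid B).comap Prod.fst ⊓ r.comap Prod.snd) z (b, ω) ↔
        z.1 = b ∧ r z.2 ω := fun z => Iff.rfl
    simp only [classWeight, this, Fintype.sum_prod_type]
    rw [Finset.sum_eq_single b]
    · simp [Finset.mul_sum]
    · intro b' _ hb'
      simp [hb']
    · simp
  simp only [partEntropy, classWeight_bot, Fintype.sum_prod_type, hcw]
  rw [← Finset.sum_neg_distrib, ← Finset.sum_neg_distrib, ← Finset.sum_add_distrib]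
  refine Finset.sum_congr rfl fun b _ => ?_
  have : P b * Real.log (P b) = ∑ ω, P b * q b ω * Real.log (P b) := by
    rw [← Finset.sum_mul, ← Finset.mul_sum, hq1, mul_one]
  rw [this, mul_neg, Finset.mul_sum, ← neg_add, ← Finset.sum_add_distrib]
  congr 1
  refine Finset.sum_congr rfl fun ω _ => ?_
  -- The logarithm of the product splits only for nonzero factors; terms of weight zero vanish on
  -- both sides.
  rcases (hP b).eq_or_lt with h0 | h0
  · simp [← h0]
  rcases (hq b ω).eq_or_lt with h0' | h0'
  · simp [← h0']
  rw [Real.log_mul h0.ne' (h0'.trans_le (le_classWeight (hq b) r ω)).ne']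
  ring

/-- Concavity of the entropy. -/
theorem partEntropy_concave {B : Type*} [Fintype B] {P : B → ℝ} (hP : ∀ b, 0 ≤ P b)
    (hP1 : ∑ b, P b = 1) {q : B → Ω → ℝ} (hq : ∀ b ω, 0 ≤ q b ω) (hq1 : ∀ b, ∑ ω, q b ω = 1)
    (r : Setoid Ω) :
    ∑ b, P b * partEntropy (q b) r ≤ partEntropy (fun ω => ∑ b, P b * q b ω) r := by
  classical
  have hQ : ∀ z : B × Ω, 0 ≤ P z.1 * q z.1 z.2 := fun z => mul_nonneg (hP _) (hq _ _)
  have hQ1 : ∑ z : B × Ω, P z.1 * q z.1 z.2 = 1 := by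
    simp [Fintype.sum_prod_type, ← Finset.mul_sum, hq1, hP1]
  -- Subadditivity for the joint law of (b, ω): the chain rule computes the left side, and the
  -- entropy of P then cancels.
  have h := partEntropy_inf_le hQ hQ1 ((⊥ : Setoid B).comap Prod.fst) (r.comap Prod.snd)
  have h1 : pushWeight Prod.fst (fun z : B × Ω => P z.1 * q z.1 z.2) = P := by
    funext b
    simp only [pushWeight, Fintype.sum_prod_type]
    rw [Finset.sum_eq_single b]
    · simp [← Finset.mul_sum, hq1]
    · intro b' _ hb'
      simp [hb']
    · simp
  have h2 : pushWeight Prod.snd (fun z : B × Ω => P z.1 * q z.1 z.2) =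
      fun ω => ∑ b, P b * q b ω := by
    funext b
    simp [pushWeight, Fintype.sum_prod_type]
  rw [partEntropy_mixture hP hq hq1, ← partEntropy_pushWeight _ Prod.fst,
    ← partEntropy_pushWeight _ Prod.snd, h1, h2] at h
  linarith

/-! ### Product weights and product partitions -/

/-- The product of partitions. -/
def piPart {K : Type*} {Ω : K → Type*} (r : ∀ k, Setoid (Ω k)) : Setoid (∀ k, Ω k) where
  r x y := ∀ k, r k (x k) (y k)
  iseqv := ⟨fun x k => (r k).refl (x k), fun h k => (r k).symm (h k),
    fun h h' k => (r k).trans (h k) (h' k)⟩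

/-- The sum factors over the coordinates; F enters only the factor at `k₀`, and all the others equal
1. -/
theorem sum_prod_mul_single {K : Type*} [Fintype K] [DecidableEq K] {Ω : K → Type*} [∀ k, Fintype (Ω k)]
    {p : ∀ k, Ω k → ℝ} (hp1 : ∀ k, ∑ x, p k x = 1) (k₀ : K) (F : Ω k₀ → ℝ) :
    ∑ x : ∀ k, Ω k, (∏ k, p k (x k)) * F (x k₀) = ∑ a, p k₀ a * F a := by
  classical
  have h := (Finset.prod_univ_sum (fun k => (Finset.univ : Finset (Ω k)))
    (fun k a => p k a * (if h : k = k₀ then F (h ▸ a) else 1))).symm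
  have h1 : ∀ x : ∀ k, Ω k, ∏ k, (p k (x k) * (if h : k = k₀ then F (h ▸ x k) else 1)) =
      (∏ k, p k (x k)) * F (x k₀) := by
    intro x
    rw [Finset.prod_mul_distrib]
    congr 1
    rw [Finset.prod_eq_single k₀]
    · simp
    · intro k _ hk
      simp [hk]
    · simp
  rw [Fintype.piFinset_univ, Finset.sum_congr rfl fun x _ => h1 x] at h
  rw [h, Finset.prod_eq_single k₀]
  · simp
  · intro k _ hk
    simp [hk, hp1]
  · simp

theorem sum_prod_eq_one {K : Type*} [Fintype K] [DecidableEq K] {Ω : K → Type*} [∀ k, Fintype (Ω k)]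
    {p : ∀ k, Ω k → ℝ} (hp1 : ∀ k, ∑ x, p k x = 1) :
    ∑ x : ∀ k, Ω k, ∏ k, p k (x k) = 1 := by
  classical
  rw [← Fintype.piFinset_univ, ← Finset.prod_univ_sum]
  simp [hp1]

theorem classWeight_piPart {K : Type*} [Fintype K] [DecidableEq K] {Ω : K → Type*} [∀ k, Fintype (Ω k)]
    (p : ∀ k, Ω k → ℝ) (r : ∀ k, Setoid (Ω k)) (x : ∀ k, Ω k) :
    classWeight (fun x => ∏ k, p k (x k)) (piPart r) x = ∏ k, classWeight (p k) (r k) (x k) := by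
  classical
  simp only [classWeight]
  rw [Finset.prod_univ_sum, Fintype.piFinset_univ]
  refine Finset.sum_congr rfl fun y _ => ?_
  have : piPart r y x ↔ ∀ k, r k (y k) (x k) := Iff.rfl
  by_cases h : piPart r y x
  · rw [if_pos h]
    exact Finset.prod_congr rfl fun k _ => (if_pos (h k)).symm
  · rw [if_neg h]
    rw [this] at h
    push Not at h
    obtain ⟨k, hk⟩ := h
    exact (Finset.prod_eq_zero (Finset.mem_univ k) (if_neg hk)).symm

theorem partEntropy_pi {K : Type*} [Fintype K] [DecidableEq K] {Ω : K → Type*} [∀ k, Fintype (Ω k)]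
    {p : ∀ k, Ω k → ℝ} (hp : ∀ k x, 0 ≤ p k x) (hp1 : ∀ k, ∑ x, p k x = 1)
    (r : ∀ k, Setoid (Ω k)) :
    partEntropy (fun x : ∀ k, Ω k => ∏ k, p k (x k)) (piPart r) =
      ∑ k, partEntropy (p k) (r k) := by
  classical
  simp only [partEntropy, classWeight_piPart, Finset.sum_neg_distrib, neg_inj]
  calc _ = ∑ x : ∀ k, Ω k, ∑ k₀, (∏ k, p k (x k)) *
        Real.log (classWeight (p k₀) (r k₀) (x k₀)) := by
        refine Finset.sum_congr rfl fun x _ => ?_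
        rw [← Finset.mul_sum]
        by_cases h : ∀ k, 0 < p k (x k)
        · rw [Real.log_prod fun k _ => ((h k).trans_le (le_classWeight (hp k) (r k) _)).ne']
        · push Not at h
          obtain ⟨k, hk⟩ := h
          rw [Finset.prod_eq_zero (Finset.mem_univ k) (le_antisymm hk (hp _ _)), zero_mul,
            zero_mul]
    _ = _ := by
        rw [Finset.sum_comm]
        exact Finset.sum_congr rfl fun k _ =>
          sum_prod_mul_single hp1 k fun a => Real.log (classWeight (p k) (r k) a)

theorem pushWeight_pi {K : Type*} [Fintype K] [DecidableEq K] {Ω Ω' : K → Type*}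
    [∀ k, Fintype (Ω k)] (p : ∀ k, Ω k → ℝ) (g : ∀ k, Ω k → Ω' k) :
    pushWeight (fun (x : ∀ k, Ω k) k => g k (x k)) (fun x => ∏ k, p k (x k)) =
      fun y => ∏ k, pushWeight (g k) (p k) (y k) := by
  classical
  funext y
  simp only [pushWeight]
  rw [Finset.prod_univ_sum, Fintype.piFinset_univ]
  refine Finset.sum_congr rfl fun x _ => ?_
  by_cases h : (fun k => g k (x k)) = y
  · rw [if_pos h]
    exact Finset.prod_congr rfl fun k _ => (if_pos (congrFun h k)).symm
  · rw [if_neg h]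
    obtain ⟨k, hk⟩ := Function.ne_iff.1 h
    exact (Finset.prod_eq_zero (Finset.mem_univ k) (if_neg hk)).symm

/-- The sum factors over K: a coordinate outside the range of e is summed freely and gives 1, and
injectivity makes every other coordinate subject to exactly one constraint. -/
theorem pushWeight_pi_comp {K L : Type*} [Fintype K] [DecidableEq K] [Fintype L]
    {Ω : K → Type*} [∀ k, Fintype (Ω k)] {p : ∀ k, Ω k → ℝ} (hp1 : ∀ k, ∑ x, p k x = 1)
    {e : L → K} (he : Function.Injective e) :
    pushWeight (fun (x : ∀ k, Ω k) l => x (e l)) (fun x => ∏ k, p k (x k)) =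
      fun y => ∏ l, p (e l) (y l) := by
  classical
  funext y
  have h1 : ∀ x : ∀ k, Ω k, (if (fun l => x (e l)) = y then ∏ k, p k (x k) else 0) =
      ∏ k, if ∀ l (h : k = e l), h ▸ x k = y l then p k (x k) else 0 := by
    intro x
    by_cases h : (fun l => x (e l)) = y
    · rw [if_pos h]
      refine Finset.prod_congr rfl fun k _ => (if_pos ?_).symm
      rintro l rfl
      exact congrFun h l
    · rw [if_neg h]
      obtain ⟨l, hl⟩ := Function.ne_iff.1 h
      exact (Finset.prod_eq_zero (Finset.mem_univ (e l)) (if_neg fun h => hl (h l rfl))).symm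
  rw [pushWeight]
  refine (Finset.sum_congr rfl fun x _ => Eq.trans (by congr) (h1 x)).trans ?_
  rw [← Fintype.piFinset_univ,
    ← Finset.prod_univ_sum (fun _ => Finset.univ)
      fun k a => if ∀ l (h : k = e l), h ▸ a = y l then p k a else 0]
  symm
  refine Fintype.prod_of_injective e he _ _ (fun k hk => ?_) fun l => ?_
  · rw [← hp1 k]
    refine Finset.sum_congr rfl fun a _ => if_pos ?_
    rintro l rfl
    exact absurd ⟨l, rfl⟩ hk
  · rw [Finset.sum_eq_single (y l)]
    · rw [if_pos]
      intro l' h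
      obtain rfl := he h
      rfl
    · intro a _ ha
      exact if_neg fun h => ha (h l rfl)
    · simp

end PartEntropy

/-! ### Partitioned spaces and their couplings -/

/-- A finite probability space with a family of partitions. -/
structure PartSpace (I : Type v) : Type (max v (w + 1)) where
  Ω : Type w
  [fintype : Fintype Ω]
  p : Ω → ℝ
  nonneg : ∀ ω, 0 ≤ p ω
  sum_eq_one : ∑ ω, p ω = 1
  part : I → Setoid Ω

attribute [instance] PartSpace.fintype

namespace PartSpace

section Basic

variable {I : Type v}

/-- The entropy of a partition of the family. -/
def ent (X : PartSpace.{v, w} I) (i : I) : ℝ := partEntropy X.p (X.part i)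

theorem ent_nonneg (X : PartSpace.{v, w} I) (i : I) : 0 ≤ X.ent i :=
  partEntropy_nonneg X.nonneg X.sum_eq_one _

/-- A coupling of the distributions of two spaces. -/
structure Coupling {I : Type*} (X Y : PartSpace I) where
  q : X.Ω × Y.Ω → ℝ
  nonneg : ∀ z, 0 ≤ q z
  fst : pushWeight Prod.fst q = X.p
  snd : pushWeight Prod.snd q = Y.p

/-- The same space with other weights. -/
def reweight (X : PartSpace.{v, w} I) (p : X.Ω → ℝ) (h0 : ∀ ω, 0 ≤ p ω) (h1 : ∑ ω, p ω = 1) :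
    PartSpace.{v, w} I where
  Ω := X.Ω
  p := p
  nonneg := h0
  sum_eq_one := h1
  part := X.part

open Classical in
/-- The independent product of a finite family of spaces. -/
def pi {K : Type*} [Fintype K] (X : K → PartSpace.{v, w} I) : PartSpace I where
  Ω := ∀ k, (X k).Ω
  p x := ∏ k, (X k).p (x k)
  nonneg x := Finset.prod_nonneg fun k _ => (X k).nonneg (x k)
  sum_eq_one := sum_prod_eq_one fun k => (X k).sum_eq_one
  part i := piPart fun k => (X k).part i

theorem ent_pi {K : Type*} [Fintype K] (X : K → PartSpace.{v, w} I) (i : I) :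
    (pi X).ent i = ∑ k, (X k).ent i := by
  classical
  exact partEntropy_pi (fun k => (X k).nonneg) (fun k => (X k).sum_eq_one) fun k => (X k).part i

end Basic

section Coupling

variable {I : Type v} {X : PartSpace.{v, w} I} {Y : PartSpace.{v, u} I}

/-- The joint partition on the space underlying a coupling. -/
def Coupling.joint (_ : Coupling X Y) (i : I) : Setoid (X.Ω × Y.Ω) :=
  (X.part i).comap Prod.fst ⊓ (Y.part i).comap Prod.snd

theorem Coupling.sum_eq_one (K : Coupling X Y) : ∑ z, K.q z = 1 := by
  rw [← X.sum_eq_one, ← K.fst, sum_pushWeight]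

theorem Coupling.ent_fst (K : Coupling X Y) (i : I) :
    X.ent i = partEntropy K.q ((X.part i).comap Prod.fst) := by
  rw [← partEntropy_pushWeight, K.fst, ent]

theorem Coupling.ent_snd (K : Coupling X Y) (i : I) :
    Y.ent i = partEntropy K.q ((Y.part i).comap Prod.snd) := by
  rw [← partEntropy_pushWeight, K.snd, ent]

theorem Coupling.ent_fst_le (K : Coupling X Y) (i : I) :
    X.ent i ≤ partEntropy K.q (K.joint i) := by
  rw [K.ent_fst]
  exact partEntropy_mono K.nonneg inf_le_left

theorem Coupling.ent_snd_le (K : Coupling X Y) (i : I) :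
    Y.ent i ≤ partEntropy K.q (K.joint i) := by
  rw [K.ent_snd]
  exact partEntropy_mono K.nonneg inf_le_right

theorem Coupling.cost_summand_nonneg (K : Coupling X Y) (i : I) :
    0 ≤ 2 * partEntropy K.q (K.joint i) - X.ent i - Y.ent i := by
  linarith [K.ent_fst_le i, K.ent_snd_le i]

/-- The coupling induced by a pair of measure-preserving maps. -/
def Coupling.ofSpan {L : Type*} [Fintype L] (p : L → ℝ) (hp : ∀ l, 0 ≤ p l) (a : L → X.Ω)
    (b : L → Y.Ω) (ha : pushWeight a p = X.p) (hb : pushWeight b p = Y.p) : Coupling X Y where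
  q := pushWeight (fun l => (a l, b l)) p
  nonneg := pushWeight_nonneg hp _
  fst := by rw [pushWeight_comp, ← ha]; rfl
  snd := by rw [pushWeight_comp, ← hb]; rfl

/-- The product coupling. -/
def Coupling.indep (X : PartSpace.{v, w} I) (Y : PartSpace.{v, u} I) : Coupling X Y where
  q z := X.p z.1 * Y.p z.2
  nonneg z := mul_nonneg (X.nonneg _) (Y.nonneg _)
  fst := by
    funext x
    simp only [pushWeight, Fintype.sum_prod_type]
    rw [Finset.sum_eq_single x]
    · simp [← Finset.mul_sum, Y.sum_eq_one]
    · intro x' _ hx'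
      simp [hx']
    · simp
  snd := by
    funext y
    simp only [pushWeight, Fintype.sum_prod_type]
    rw [Finset.sum_comm, Finset.sum_eq_single y]
    · simp [← Finset.sum_mul, X.sum_eq_one]
    · intro y' _ hy'
      simp [hy']
    · simp

instance : Nonempty (Coupling X Y) := ⟨Coupling.indep X Y⟩

end Coupling

/-! ### The intrinsic distance of partitioned spaces -/

section Dist

variable {I : Type v} [Fintype I]

/-- The total entropy. -/
def totalEnt (X : PartSpace.{v, w} I) : ℝ := ∑ i, X.ent i

theorem totalEnt_nonneg (X : PartSpace.{v, w} I) : 0 ≤ X.totalEnt :=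
  Finset.sum_nonneg fun i _ => X.ent_nonneg i

theorem totalEnt_pi {K : Type*} [Fintype K] (X : K → PartSpace.{v, w} I) :
    (pi X).totalEnt = ∑ k, (X k).totalEnt := by
  simp only [totalEnt, ent_pi]
  exact Finset.sum_comm

variable {X : PartSpace.{v, w} I} {Y : PartSpace.{v, u} I}

/-- The entropy distance of a coupling. -/
def Coupling.cost (K : Coupling X Y) : ℝ :=
  ∑ i, (2 * partEntropy K.q (K.joint i) - X.ent i - Y.ent i)

theorem Coupling.cost_nonneg (K : Coupling X Y) : 0 ≤ K.cost :=
  Finset.sum_nonneg fun i _ => K.cost_summand_nonneg i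

/-- The intrinsic entropy distance. -/
def dist (X : PartSpace.{v, w} I) (Y : PartSpace.{v, u} I) : ℝ := ⨅ K : Coupling X Y, K.cost

theorem dist_le_cost (K : Coupling X Y) : dist X Y ≤ K.cost :=
  ciInf_le ⟨0, by rintro _ ⟨K, rfl⟩; exact K.cost_nonneg⟩ K

theorem dist_nonneg (X : PartSpace.{v, w} I) (Y : PartSpace.{v, u} I) : 0 ≤ dist X Y :=
  le_ciInf fun K => K.cost_nonneg

theorem exists_cost_lt (X : PartSpace.{v, w} I) (Y : PartSpace.{v, u} I) {ε : ℝ} (hε : 0 < ε) :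
    ∃ K : Coupling X Y, K.cost < dist X Y + ε :=
  exists_lt_of_ciInf_lt (lt_add_of_pos_right _ hε)

theorem dist_le_of_span {L : Type*} [Fintype L] (p : L → ℝ) (hp : ∀ l, 0 ≤ p l) (a : L → X.Ω)
    (b : L → Y.Ω) (ha : pushWeight a p = X.p) (hb : pushWeight b p = Y.p) :
    dist X Y ≤
      ∑ i, (2 * partEntropy p ((X.part i).comap a ⊓ (Y.part i).comap b) - X.ent i - Y.ent i) := by
  refine (dist_le_cost (Coupling.ofSpan p hp a b ha hb)).trans (le_of_eq ?_)
  refine Finset.sum_congr rfl fun i _ => ?_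
  congr 3
  exact partEntropy_pushWeight _ _ _

theorem dist_comm_le (X : PartSpace.{v, w} I) (Y : PartSpace.{v, u} I) : dist Y X ≤ dist X Y := by
  refine le_ciInf fun K => (dist_le_of_span K.q K.nonneg Prod.snd Prod.fst K.snd K.fst).trans ?_
  refine Finset.sum_le_sum fun i _ => ?_
  rw [inf_comm]
  exact (sub_right_comm _ _ _).le

theorem dist_comm (X : PartSpace.{v, w} I) (Y : PartSpace.{v, u} I) : dist X Y = dist Y X :=
  le_antisymm (dist_comm_le Y X) (dist_comm_le X Y)

/-- Couple along the graph of g: the joint partition is then that of X, so the cost is the loss of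
entropy. -/
theorem dist_le_of_map (g : X.Ω → Y.Ω) (hg : pushWeight g X.p = Y.p)
    (h : ∀ i, X.part i ≤ (Y.part i).comap g) : dist X Y ≤ X.totalEnt - Y.totalEnt := by
  refine (dist_le_of_span X.p X.nonneg id g (pushWeight_id _) hg).trans (le_of_eq ?_)
  rw [totalEnt, totalEnt, ← Finset.sum_sub_distrib]
  refine Finset.sum_congr rfl fun i _ => ?_
  have : (X.part i).comap id ⊓ (Y.part i).comap g = X.part i := inf_eq_left.2 (h i)
  rw [this, ent]
  ring

theorem dist_eq_zero_of_map (g : X.Ω → Y.Ω) (hg : pushWeight g X.p = Y.p)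
    (h : ∀ i, X.part i = (Y.part i).comap g) : dist X Y = 0 := by
  refine le_antisymm ((dist_le_of_map g hg fun i => (h i).le).trans (le_of_eq ?_)) (dist_nonneg _ _)
  refine sub_eq_zero.2 (Finset.sum_congr rfl fun i _ => ?_)
  rw [ent, ent, ← hg, partEntropy_pushWeight, h i]

theorem dist_self (X : PartSpace.{v, w} I) : dist X X = 0 :=
  dist_eq_zero_of_map id (pushWeight_id _) fun _ => rfl

/-- Glue two near-optimal couplings conditionally independently over Y. Submodularity gives H(X,Y,Z)
+ H(Y) ≤ H(X,Y) + H(Y,Z) for each index. -/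
theorem dist_triangle (X : PartSpace.{v, w₁} I) (Y : PartSpace.{v, w₂} I)
    (Z : PartSpace.{v, w₃} I) : dist X Z ≤ dist X Y + dist Y Z := by
  classical
  refine le_of_forall_pos_le_add fun ε hε => ?_
  obtain ⟨K, hK⟩ := exists_cost_lt X Y (half_pos hε)
  obtain ⟨K', hK'⟩ := exists_cost_lt Y Z (half_pos hε)
  have hKy : ∀ y, ∑ x, K.q (x, y) = Y.p y := fun y => by
    rw [← congrFun K.snd y]; simp [pushWeight, Fintype.sum_prod_type]
  have hKy' : ∀ y, ∑ z, K'.q (y, z) = Y.p y := fun y => by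
    rw [← congrFun K'.fst y]
    simp only [pushWeight, Fintype.sum_prod_type]
    rw [Finset.sum_eq_single y]
    · simp
    · intro x' _ hx'
      simp [hx']
    · simp
  -- Points of Y without mass carry no mass of either coupling, so the division by `Y.p y` below is
  -- harmless.
  have h0 : ∀ x y, Y.p y = 0 → K.q (x, y) = 0 := fun x y h => by
    rw [← hKy, Finset.sum_eq_zero_iff_of_nonneg fun x _ => K.nonneg _] at h
    exact h x (Finset.mem_univ x)
  have h0' : ∀ y z, Y.p y = 0 → K'.q (y, z) = 0 := fun y z h => by
    rw [← hKy', Finset.sum_eq_zero_iff_of_nonneg fun x _ => K'.nonneg _] at h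
    exact h z (Finset.mem_univ z)
  set Q : X.Ω × Y.Ω × Z.Ω → ℝ := fun t => K.q (t.1, t.2.1) * K'.q (t.2.1, t.2.2) / Y.p t.2.1
    with hQ
  have hQ0 : ∀ t, 0 ≤ Q t := fun t =>
    div_nonneg (mul_nonneg (K.nonneg _) (K'.nonneg _)) (Y.nonneg _)
  have hQ1 : pushWeight (fun t : X.Ω × Y.Ω × Z.Ω => (t.1, t.2.1)) Q = K.q := by
    funext ⟨x, y⟩
    have : pushWeight (fun t : X.Ω × Y.Ω × Z.Ω => (t.1, t.2.1)) Q (x, y) =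
        ∑ z, K.q (x, y) * K'.q (y, z) / Y.p y := by
      simp only [pushWeight, Fintype.sum_prod_type, Prod.mk.injEq]
      rw [Finset.sum_eq_single x, Finset.sum_eq_single y]
      · simp [hQ]
      · intro x' _ hx'
        simp [hx']
      · simp
      · intro x' _ hx'
        simp [hx']
      · simp
    rw [this, ← Finset.sum_div, ← Finset.mul_sum, hKy']
    by_cases h : Y.p y = 0
    · simp [h, h0 x y h]
    · field_simp
  have hQ2 : pushWeight (fun t : X.Ω × Y.Ω × Z.Ω => t.2) Q = K'.q := by
    funext ⟨y, z⟩
    have : pushWeight (fun t : X.Ω × Y.Ω × Z.Ω => t.2) Q (y, z) =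
        ∑ x, K.q (x, y) * K'.q (y, z) / Y.p y := by
      simp [pushWeight, Fintype.sum_prod_type, hQ]
    rw [this, ← Finset.sum_div, ← Finset.sum_mul, hKy]
    by_cases h : Y.p y = 0
    · simp [h, h0' y z h]
    · field_simp
  have hQs : ∑ t, Q t = 1 := by rw [← K.sum_eq_one, ← hQ1, sum_pushWeight]
  have hle := dist_le_of_span (X := X) (Y := Z) Q hQ0 (fun t => t.1) (fun t => t.2.2)
    (by rw [← K.fst, ← hQ1, pushWeight_comp]; rfl)
    (by rw [← K'.snd, ← hQ2, pushWeight_comp]; rfl)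
  have hfin : ∑ i, (2 * partEntropy Q ((X.part i).comap (fun t => t.1) ⊓
      (Z.part i).comap (fun t => t.2.2)) - X.ent i - Z.ent i) ≤ K.cost + K'.cost := by
    rw [Coupling.cost, Coupling.cost, ← Finset.sum_add_distrib]
    refine Finset.sum_le_sum fun i _ => ?_
    have hsub := partEntropy_submodular hQ0 hQs ((X.part i).comap fun t => t.1)
      ((Z.part i).comap fun t => t.2.2) ((Y.part i).comap fun t => t.2.1)
    have e1 : partEntropy K.q (K.joint i) = partEntropy Q ((X.part i).comap (fun t => t.1) ⊓
        (Y.part i).comap fun t => t.2.1) := by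
      rw [← hQ1, partEntropy_pushWeight]; rfl
    have e2 : partEntropy K'.q (K'.joint i) = partEntropy Q ((Z.part i).comap (fun t => t.2.2) ⊓
        (Y.part i).comap fun t => t.2.1) := by
      rw [← hQ2, partEntropy_pushWeight, inf_comm]; rfl
    have e3 : Y.ent i = partEntropy Q ((Y.part i).comap fun t => t.2.1) := by
      rw [K.ent_snd, ← hQ1, partEntropy_pushWeight]; rfl
    have e4 := partEntropy_mono hQ0 (inf_le_left : (X.part i).comap (fun t => t.1) ⊓
      (Z.part i).comap (fun t => t.2.2) ⊓ (Y.part i).comap (fun t => t.2.1) ≤ _)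
    rw [← e1, ← e2, ← e3] at hsub
    linarith
  linarith

/-- Distance zero plays the role of isomorphism, also between spaces in different universes. -/
theorem dist_congr_left {X : PartSpace.{v, w₁} I} {X' : PartSpace.{v, w₂} I}
    (h : dist X X' = 0) (Y : PartSpace.{v, w₃} I) : dist X Y = dist X' Y := by
  have h1 := dist_triangle X X' Y
  have h2 := dist_triangle X' X Y
  rw [dist_comm X' X] at h2
  linarith

theorem dist_congr {X : PartSpace.{v, w₁} I} {X' : PartSpace.{v, w₂} I}
    {Y : PartSpace.{v, w₃} I} {Y' : PartSpace.{v, w₄} I}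
    (h : dist X X' = 0) (h' : dist Y Y' = 0) : dist X Y = dist X' Y' := by
  rw [dist_congr_left h, dist_comm, dist_congr_left h', dist_comm]

theorem abs_dist_sub_dist_le (X : PartSpace.{v, w₁} I) (X' : PartSpace.{v, w₂} I)
    (Y : PartSpace.{v, w₃} I) (Y' : PartSpace.{v, w₄} I) :
    |dist X Y - dist X' Y'| ≤ dist X X' + dist Y Y' := by
  have h1 := dist_triangle X X' Y
  have h2 := dist_triangle X' Y' Y
  have h3 := dist_triangle X' X Y'
  have h4 := dist_triangle X Y Y'
  rw [dist_comm Y' Y] at h2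
  rw [dist_comm X' X] at h3
  rw [abs_le]
  constructor <;> linarith

/-- The product of near-optimal couplings is a coupling of the products, and its cost is the sum of
the costs because entropies add. -/
theorem dist_pi_le {K : Type*} [Fintype K] (X : K → PartSpace.{v, w} I)
    (Y : K → PartSpace.{v, u} I) : dist (pi X) (pi Y) ≤ ∑ k, dist (X k) (Y k) := by
  classical
  refine le_of_forall_pos_le_add fun ε hε => ?_
  -- The summand 1 keeps the denominator positive when K is empty.
  have hε' : 0 < ε / (Fintype.card K + 1) := by positivity
  choose C hC using fun k => exists_cost_lt (X k) (Y k) hε'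
  have ha : pushWeight (fun (z : ∀ k, (X k).Ω × (Y k).Ω) k => (z k).1)
      (fun z => ∏ k, (C k).q (z k)) = (pi X).p := by
    refine (pushWeight_pi (fun k => (C k).q) (fun k => Prod.fst)).trans ?_
    funext x
    exact Finset.prod_congr rfl fun k _ => by rw [(C k).fst]
  have hb : pushWeight (fun (z : ∀ k, (X k).Ω × (Y k).Ω) k => (z k).2)
      (fun z => ∏ k, (C k).q (z k)) = (pi Y).p := by
    refine (pushWeight_pi (fun k => (C k).q) (fun k => Prod.snd)).trans ?_
    funext x
    exact Finset.prod_congr rfl fun k _ => by rw [(C k).snd]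
  have h := dist_le_of_span (X := pi X) (Y := pi Y) _
    (fun z => Finset.prod_nonneg fun k _ => (C k).nonneg (z k)) _ _ ha hb
  have hcost : ∑ i, (2 * partEntropy (fun z : ∀ k, (X k).Ω × (Y k).Ω => ∏ k, (C k).q (z k))
      (((pi X).part i).comap (fun z k => (z k).1) ⊓ ((pi Y).part i).comap fun z k => (z k).2) -
      (pi X).ent i - (pi Y).ent i) = ∑ k, (C k).cost := by
    simp only [Coupling.cost]
    rw [Finset.sum_comm]
    refine Finset.sum_congr rfl fun i _ => ?_
    rw [ent_pi, ent_pi, Finset.sum_sub_distrib, Finset.sum_sub_distrib, ← Finset.mul_sum,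
      ← partEntropy_pi (fun k => (C k).nonneg) fun k => (C k).sum_eq_one]
    congr 4
    ext z z'
    exact ⟨fun h k => ⟨h.1 k, h.2 k⟩, fun h => ⟨fun k => (h k).1, fun k => (h k).2⟩⟩
  refine (h.trans hcost.le).trans ((Finset.sum_le_sum fun k _ => (hC k).le).trans ?_)
  rw [Finset.sum_add_distrib, Finset.sum_const, Finset.card_univ, nsmul_eq_mul]
  have : (Fintype.card K : ℝ) * (ε / (Fintype.card K + 1)) ≤ ε := by
    rw [mul_div_assoc', div_le_iff₀ (by positivity)]
    nlinarith
  linarith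

theorem dist_pi_eq_zero {K : Type*} [Fintype K] {X : K → PartSpace.{v, w} I}
    {Y : K → PartSpace.{v, u} I} (h : ∀ k, dist (X k) (Y k) = 0) : dist (pi X) (pi Y) = 0 :=
  le_antisymm ((dist_pi_le X Y).trans (by simp [h])) (dist_nonneg _ _)

/-- Forgetting factors is a measure-preserving map, so it costs at most the entropy of the factors
forgotten. -/
theorem dist_pi_comp_le {K L : Type*} [Fintype K] [Fintype L] (X : K → PartSpace.{v, w} I)
    {e : L → K} (he : Function.Injective e) :
    dist (pi X) (pi fun l => X (e l)) ≤ ∑ k, (X k).totalEnt - ∑ l, (X (e l)).totalEnt := by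
  classical
  refine (dist_le_of_map (X := pi X) (Y := pi fun l => X (e l)) (fun x l => x (e l)) ?_
    fun i x y h l => h (e l)).trans ?_
  · exact pushWeight_pi_comp (fun k => (X k).sum_eq_one) he
  · rw [totalEnt_pi, totalEnt_pi]

theorem dist_pi_equiv {K L : Type*} [Fintype K] [Fintype L] (X : K → PartSpace.{v, w} I)
    (e : L ≃ K) : dist (pi X) (pi fun l => X (e l)) = 0 := by
  refine le_antisymm ((dist_pi_comp_le X e.injective).trans (le_of_eq ?_)) (dist_nonneg _ _)
  rw [e.sum_comp fun k => (X k).totalEnt, sub_self]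

theorem dist_pi_sigma {A : Type*} [Fintype A] {K : A → Type*} [∀ a, Fintype (K a)]
    (X : ∀ a, K a → PartSpace.{v, w} I) :
    dist (pi fun a => pi (X a)) (pi fun z : Σ a, K a => X z.1 z.2) = 0 := by
  classical
  refine dist_eq_zero_of_map (fun x z => x z.1 z.2) ?_ fun i => ?_
  · funext y
    obtain ⟨x, rfl⟩ := (Equiv.piCurry fun a k => (X a k).Ω).symm.surjective y
    refine (pushWeight_apply_equiv _ (Equiv.piCurry fun a k => (X a k).Ω).symm x).trans ?_
    exact (Fintype.prod_sigma (fun z : Σ a, K a => (X z.1 z.2).p (x z.1 z.2))).symm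
  · ext x y
    exact ⟨fun h z => h z.1 z.2, fun h a k => h ⟨a, k⟩⟩

/-- The slicing inequality. -/
theorem dist_le_sum_slices {B : Type*} [Fintype B] {P : B → ℝ} (hP : ∀ b, 0 ≤ P b)
    (hP1 : ∑ b, P b = 1) (X : PartSpace.{v, w} I) {q : B → X.Ω → ℝ} (hq : ∀ b ω, 0 ≤ q b ω)
    (hq1 : ∀ b, ∑ ω, q b ω = 1) (hX : ∀ ω, X.p ω = ∑ b, P b * q b ω) (Y : PartSpace.{v, u} I) :
    dist X Y ≤ ∑ b, P b * dist (X.reweight (q b) (hq b) (hq1 b)) Y +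
      2 * Fintype.card I * partEntropy P ⊥ := by
  classical
  refine le_of_forall_pos_le_add fun ε hε => ?_
  -- Draw b with law P, then a point of a near-optimal coupling of the b-th slice with Y. The first
  -- marginals average to X, and the second one is Y for every b.
  choose C hC using fun b => exists_cost_lt (X.reweight (q b) (hq b) (hq1 b)) Y hε
  have ha : pushWeight (fun z : B × X.Ω × Y.Ω => z.2.1) (fun z => P z.1 * (C z.1).q z.2) = X.p := by
    funext ω
    rw [hX]
    simp only [pushWeight, Fintype.sum_prod_type]
    refine Finset.sum_congr rfl fun b _ => ?_
    have := congrFun (C b).fst ω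
    simp only [pushWeight, Fintype.sum_prod_type] at this
    change _ = P b * (X.reweight (q b) (hq b) (hq1 b)).p ω
    rw [← this, Finset.mul_sum]
    refine Finset.sum_congr rfl fun x _ => ?_
    rw [Finset.mul_sum]
    refine Finset.sum_congr rfl fun y _ => ?_
    by_cases h : x = ω
    · exact (if_pos h).trans (congrArg (P b * ·) (if_pos h).symm)
    · exact (if_neg h).trans ((mul_zero _).symm.trans (congrArg (P b * ·) (if_neg h).symm))
  have hb : pushWeight (fun z : B × X.Ω × Y.Ω => z.2.2) (fun z => P z.1 * (C z.1).q z.2) = Y.p := by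
    funext ω
    have h1 : Y.p ω = ∑ b, P b * Y.p ω := by rw [← Finset.sum_mul, hP1, one_mul]
    rw [h1]
    simp only [pushWeight, Fintype.sum_prod_type]
    refine Finset.sum_congr rfl fun b _ => ?_
    have := congrFun (C b).snd ω
    simp only [pushWeight, Fintype.sum_prod_type] at this
    rw [← this, Finset.mul_sum]
    refine Finset.sum_congr rfl fun x _ => ?_
    rw [Finset.mul_sum]
    refine Finset.sum_congr rfl fun y _ => ?_
    by_cases h : y = ω
    · exact (if_pos h).trans (congrArg (P b * ·) (if_pos h).symm)
    · exact (if_neg h).trans ((mul_zero _).symm.trans (congrArg (P b * ·) (if_neg h).symm))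
  have hQ0 : ∀ z : B × X.Ω × Y.Ω, 0 ≤ P z.1 * (C z.1).q z.2 := fun z =>
    mul_nonneg (hP z.1) ((C z.1).nonneg z.2)
  have h := dist_le_of_span (X := X) (Y := Y) _ hQ0 _ _ ha hb
  have hi : ∀ i, 2 * partEntropy (fun z : B × X.Ω × Y.Ω => P z.1 * (C z.1).q z.2)
      ((X.part i).comap (fun z => z.2.1) ⊓ (Y.part i).comap fun z => z.2.2) -
      X.ent i - Y.ent i ≤ 2 * partEntropy P ⊥ + ∑ b, P b *
        (2 * partEntropy (C b).q ((C b).joint i) -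
          (X.reweight (q b) (hq b) (hq1 b)).ent i - Y.ent i) := by
    intro i
    -- Adding b to the joint partition can only raise the entropy, and the chain rule evaluates the
    -- result.
    have e1 := partEntropy_mono hQ0 (inf_le_right :
      (⊥ : Setoid B).comap (Prod.fst : B × X.Ω × Y.Ω → B) ⊓
      ((X.part i).comap Prod.fst ⊓ (Y.part i).comap Prod.snd).comap Prod.snd ≤ _)
    replace e1 := e1.trans (partEntropy_mixture (Ω := X.Ω × Y.Ω) hP (q := fun b => (C b).q)
      (fun b => (C b).nonneg) (fun b => (C b).sum_eq_one) _).le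
    have e2 : ∑ b, P b * (X.reweight (q b) (hq b) (hq1 b)).ent i ≤ X.ent i := by
      have := partEntropy_concave hP hP1 hq hq1 (X.part i)
      rwa [← funext hX] at this
    have e3 : Y.ent i = ∑ b, P b * Y.ent i := by rw [← Finset.sum_mul, hP1, one_mul]
    simp only [mul_sub, Finset.sum_sub_distrib]
    rw [← e3]
    have e4 : ∑ b, P b * (2 * partEntropy (C b).q ((C b).joint i)) =
        2 * ∑ b, P b * partEntropy (C b).q ((C b).joint i) := by
      rw [Finset.mul_sum]
      exact Finset.sum_congr rfl fun b _ => by ring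
    rw [e4]
    have e5 : partEntropy (fun z : B × X.Ω × Y.Ω => P z.1 * (C z.1).q z.2)
        ((X.part i).comap (fun z => z.2.1) ⊓ (Y.part i).comap fun z => z.2.2) ≤
        partEntropy P ⊥ + ∑ b, P b * partEntropy (C b).q ((C b).joint i) := e1
    linarith
  refine h.trans ((Finset.sum_le_sum fun i _ => hi i).trans ?_)
  rw [Finset.sum_add_distrib, Finset.sum_const, Finset.card_univ, nsmul_eq_mul, Finset.sum_comm]
  have : ∑ b, ∑ i, P b * (2 * partEntropy (C b).q ((C b).joint i) -
      (X.reweight (q b) (hq b) (hq1 b)).ent i - Y.ent i) ≤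
      ∑ b, P b * dist (X.reweight (q b) (hq b) (hq1 b)) Y + ε := by
    have h1 : ε = ∑ b, P b * ε := by rw [← Finset.sum_mul, hP1, one_mul]
    rw [h1, ← Finset.sum_add_distrib]
    refine Finset.sum_le_sum fun b _ => ?_
    rw [← Finset.mul_sum, ← mul_add]
    exact mul_le_mul_of_nonneg_left (hC b).le (hP b)
  linarith

end Dist

end PartSpace

/-! ### Products with prescribed multiplicities -/

namespace PartSpace

section Powers

variable {I : Type v} [Fintype I] {T : Type*} [Fintype T]

/-- The independent product of `n t` copies of `D t` for each `t`. -/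
def powers {I : Type v} {T : Type*} [Fintype T] (D : T → PartSpace.{v, w} I) (n : T → ℕ) :
    PartSpace I :=
  pi fun z : Σ t, Fin (n t) => D z.1

theorem dist_powers_le_of_le (D : T → PartSpace.{v, w} I) {n m : T → ℕ} (h : m ≤ n) :
    dist (powers D n) (powers D m) ≤ ∑ t, ((n t : ℝ) - m t) * (D t).totalEnt := by
  have he : Function.Injective (Sigma.map id fun t => Fin.castLE (h t) :
      (Σ t, Fin (m t)) → Σ t, Fin (n t)) :=
    Function.injective_id.sigma_map fun t => Fin.castLE_injective (h t)
  refine (dist_pi_comp_le (fun z : Σ t, Fin (n t) => D z.1) he).trans (le_of_eq ?_)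
  simp only [Fintype.sum_sigma, Sigma.map, id, Finset.sum_const, Finset.card_univ,
    Fintype.card_fin, nsmul_eq_mul, sub_mul, Finset.sum_sub_distrib]

/-- Both products project onto the one whose multiplicities are the pointwise minimum. -/
theorem dist_powers_le (D : T → PartSpace.{v, w} I) (n m : T → ℕ) :
    dist (powers D n) (powers D m) ≤ ∑ t, |(n t : ℝ) - m t| * (D t).totalEnt := by
  have h1 := dist_powers_le_of_le D (inf_le_left : n ⊓ m ≤ n)
  have h2 := dist_powers_le_of_le D (inf_le_right : n ⊓ m ≤ m)
  rw [dist_comm] at h2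
  refine (dist_triangle _ (powers D (n ⊓ m)) _).trans ((add_le_add h1 h2).trans (le_of_eq ?_))
  rw [← Finset.sum_add_distrib]
  refine Finset.sum_congr rfl fun t _ => ?_
  rw [← add_mul]
  congr 1
  rcases le_total (n t) (m t) with h | h
  · have h' : (n t : ℝ) ≤ m t := by exact_mod_cast h
    rw [Pi.inf_apply, inf_eq_left.2 h, abs_of_nonpos (by linarith)]
    ring
  · have h' : (m t : ℝ) ≤ n t := by exact_mod_cast h
    rw [Pi.inf_apply, inf_eq_right.2 h, abs_of_nonneg (by linarith)]
    ring

/-- A product depends, up to distance zero, only on how often each factor occurs: group the indices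
by the fibres of f. -/
theorem dist_pi_comp_powers {K : Type*} [Fintype K] [DecidableEq T] (D : T → PartSpace.{v, w} I)
    (f : K → T) :
    dist (pi fun k => D (f k)) (powers D fun t => (Finset.univ.filter fun k => f k = t).card) =
      0 := by
  classical
  have e : ∀ t, Fin (Finset.univ.filter fun k => f k = t).card ≃ {k // f k = t} := fun t =>
    (Fintype.equivFinOfCardEq (by rw [Fintype.card_subtype])).symm
  have h := dist_pi_equiv (fun k => D (f k))
    ((Equiv.sigmaCongrRight e).trans (Equiv.sigmaFiberEquiv f))
  have h2 : ∀ z, f (((Equiv.sigmaCongrRight e).trans (Equiv.sigmaFiberEquiv f)) z) = z.1 :=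
    fun z => (e z.1 z.2).2
  simp only [h2] at h
  exact h

theorem dist_pi_comp_powers_le {K : Type*} [Fintype K] [DecidableEq T]
    (D : T → PartSpace.{v, w} I) (f : K → T) (n : T → ℕ) :
    dist (pi fun k => D (f k)) (powers D n) ≤
      ∑ t, |((Finset.univ.filter fun k => f k = t).card : ℝ) - n t| * (D t).totalEnt := by
  rw [dist_congr_left (dist_pi_comp_powers D f)]
  exact dist_powers_le _ _ _

theorem dist_pi_powers {A : Type*} [Fintype A] (D : T → PartSpace.{v, w} I) (n : A → T → ℕ) :
    dist (pi fun a => powers D (n a)) (powers D fun t => ∑ a, n a t) = 0 := by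
  classical
  refine (dist_congr_left (dist_pi_sigma fun a (z : Σ t, Fin (n a t)) => D z.1) _).trans ?_
  have h := dist_pi_comp_powers D fun z : Σ a, Σ t, Fin (n a t) => z.2.1
  have h2 : ∀ t, (Finset.univ.filter fun z : Σ a, Σ t, Fin (n a t) => z.2.1 = t).card =
      ∑ a, n a t := by
    intro t
    rw [Finset.card_filter, Fintype.sum_sigma]
    refine Finset.sum_congr rfl fun a _ => ?_
    rw [Fintype.sum_sigma, Finset.sum_eq_single t]
    · simp
    · intro t' _ h'
      simp [h']
    · simp
  simp only [h2] at h
  exact h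

theorem dist_powers_congr (D : T → PartSpace.{v, w₁} I) (E : T → PartSpace.{v, w₂} I)
    (n : T → ℕ) : dist (powers D n) (powers E n) ≤ ∑ t, n t * dist (D t) (E t) :=
  (dist_pi_le _ _).trans (le_of_eq (by simp [Fintype.sum_sigma]))

/-- The subadditivity that feeds Fekete's lemma, obtained from a product over two indices. -/
theorem dist_powers_add_le {S : Type*} [Fintype S] (D : T → PartSpace.{v, w₁} I)
    (E : S → PartSpace.{v, w₂} I) (n n' : T → ℕ) (m m' : S → ℕ) :
    dist (powers D (n + n')) (powers E (m + m')) ≤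
      dist (powers D n) (powers E m) + dist (powers D n') (powers E m') := by
  have h1 := dist_pi_powers D fun b : Bool => bif b then n else n'
  have h2 := dist_pi_powers E fun b : Bool => bif b then m else m'
  have h3 := dist_pi_le (fun b : Bool => powers D (bif b then n else n'))
    (fun b : Bool => powers E (bif b then m else m'))
  rw [dist_congr h1 h2] at h3
  change dist (powers D fun t => n t + n' t) (powers E fun t => m t + m' t) ≤ _
  simpa using h3

end Powers

/-! ### Deviation of letter counts in random words -/

theorem sum_prod_mul_sum_sq {B : Type*} [Fintype B] {P : B → ℝ} (hP1 : ∑ b, P b = 1)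
    {g : B → ℝ} (hg : ∑ b, P b * g b = 0) (k : ℕ) :
    ∑ x : Fin k → B, (∏ j, P (x j)) * (∑ j, g (x j)) ^ 2 = k * ∑ b, P b * g b ^ 2 := by
  classical
  have hdiag : ∀ j : Fin k, ∑ x : Fin k → B, (∏ j, P (x j)) * (g (x j) * g (x j)) =
      ∑ b, P b * g b ^ 2 := fun j => by
    have := sum_prod_mul_single (p := fun _ : Fin k => P) (fun _ => hP1) j fun a => g a * g a
    rw [this]
    exact Finset.sum_congr rfl fun b _ => by ring
  -- Off the diagonal the expectation factors, and the i-th factor is the mean of g, which is zero.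
  have hoff : ∀ i j : Fin k, i ≠ j →
      ∑ x : Fin k → B, (∏ j, P (x j)) * (g (x i) * g (x j)) = 0 := by
    intro i j hij
    have h := (Finset.prod_univ_sum (fun _ : Fin k => (Finset.univ : Finset B)) fun l a =>
      P a * ((if l = i then g a else 1) * (if l = j then g a else 1))).symm
    have h0 : ∏ l : Fin k, ∑ a, P a * ((if l = i then g a else 1) * (if l = j then g a else 1)) =
        0 := Finset.prod_eq_zero (Finset.mem_univ i) (by simpa [hij] using hg)
    rw [h0, Fintype.piFinset_univ] at h
    rw [← h]
    refine Finset.sum_congr rfl fun x _ => ?_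
    rw [Finset.prod_mul_distrib, Finset.prod_mul_distrib]
    simp
  calc _ = ∑ x : Fin k → B, ∑ i, ∑ j, (∏ j, P (x j)) * (g (x i) * g (x j)) := by
        refine Finset.sum_congr rfl fun x _ => ?_
        rw [sq, Finset.sum_mul_sum, Finset.mul_sum]
        exact Finset.sum_congr rfl fun i _ => Finset.mul_sum _ _ _
    _ = ∑ i, ∑ j, ∑ x : Fin k → B, (∏ j, P (x j)) * (g (x i) * g (x j)) := by
        rw [Finset.sum_comm]
        exact Finset.sum_congr rfl fun i _ => Finset.sum_comm
    _ = ∑ i : Fin k, ∑ b, P b * g b ^ 2 := by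
        refine Finset.sum_congr rfl fun i _ => ?_
        rw [Finset.sum_eq_single i fun j _ hj => hoff i j hj.symm, hdiag]
        simp
    _ = _ := by simp

/-- The mean absolute deviation of a binomial distribution. -/
theorem sum_prod_mul_abs_card_sub_le {B : Type*} [Fintype B] [DecidableEq B] {P : B → ℝ}
    (hP : ∀ b, 0 ≤ P b) (hP1 : ∑ b, P b = 1) (k : ℕ) (b : B) :
    ∑ x : Fin k → B, (∏ j, P (x j)) *
      |((Finset.univ.filter fun j => x j = b).card : ℝ) - k * P b| ≤ √k + 1 := by
  -- Adding 1 keeps s positive for k = 0; the variance is at most k ≤ s².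
  set s := √(k : ℝ) + 1 with hs
  have hs0 : 0 < s := by positivity
  have hks : (k : ℝ) ≤ s ^ 2 := by
    have := Real.sq_sqrt (Nat.cast_nonneg (α := ℝ) k)
    nlinarith [Real.sqrt_nonneg (k : ℝ)]
  set g : B → ℝ := fun b' => (if b' = b then 1 else 0) - P b with hgdef
  have hg : ∑ b, P b * g b = 0 := by
    simp [hgdef, mul_sub, Finset.sum_sub_distrib, ← Finset.sum_mul, hP1]
  have hPb : ∀ b, P b ≤ 1 := fun b =>
    hP1 ▸ Finset.single_le_sum (fun b _ => hP b) (Finset.mem_univ b)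
  have hg2 : ∑ b, P b * g b ^ 2 ≤ 1 := by
    rw [← hP1]
    refine Finset.sum_le_sum fun b' _ => mul_le_of_le_one_right (hP b') ?_
    rw [sq_le_one_iff_abs_le_one, abs_le]
    simp only [hgdef]
    split_ifs <;> constructor <;> linarith [hP b, hPb b]
  have hsum : ∀ x : Fin k → B, ((Finset.univ.filter fun j => x j = b).card : ℝ) - k * P b =
      ∑ j, g (x j) := by
    intro x
    simp [hgdef, Finset.sum_sub_distrib]
  -- The arithmetic-geometric mean inequality turns the second moment into a bound for the first
  -- absolute moment.
  have habs : ∀ z : ℝ, |z| ≤ z ^ 2 / (2 * s) + s / 2 := by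
    intro z
    rw [div_add_div _ _ (by positivity) (by positivity), le_div_iff₀ (by positivity)]
    nlinarith [sq_nonneg (|z| - s), sq_abs z]
  calc _ ≤ ∑ x : Fin k → B, ((∏ j, P (x j)) * (∑ j, g (x j)) ^ 2 * (1 / (2 * s)) +
        (∏ j, P (x j)) * (s / 2)) := by
        refine Finset.sum_le_sum fun x _ => ?_
        rw [hsum]
        have := mul_le_mul_of_nonneg_left (habs (∑ j, g (x j)))
          (Finset.prod_nonneg fun j _ => hP (x j) : 0 ≤ ∏ j, P (x j))
        refine this.trans (le_of_eq ?_)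
        ring
    _ = k * (∑ b, P b * g b ^ 2) * (1 / (2 * s)) + s / 2 := by
        rw [Finset.sum_add_distrib, ← Finset.sum_mul, ← Finset.sum_mul,
          sum_prod_mul_sum_sq hP1 hg, sum_prod_eq_one fun _ => hP1, one_mul]
    _ ≤ s ^ 2 * (1 / (2 * s)) + s / 2 := by
        gcongr
        nlinarith [Nat.cast_nonneg (α := ℝ) k]
    _ = s := by field_simp; ring

/-! ### Powers of mixtures -/

section Slicing

variable {I : Type v} [Fintype I]

theorem piPart_bot {K : Type*} (Ω : K → Type*) :
    piPart (fun k => (⊥ : Setoid (Ω k))) = ⊥ := by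
  ext x y
  exact ⟨fun h => funext h, fun h k => congrFun h k⟩

/-- A power of a mixture is close to the product of powers of the components with the expected
multiplicities, up to the entropy of the mixing distribution. -/
theorem dist_pi_mixture_powers_le {B : Type*} [Fintype B] {P : B → ℝ} (hP : ∀ b, 0 ≤ P b)
    (hP1 : ∑ b, P b = 1) (X : PartSpace.{v, w} I) {q : B → X.Ω → ℝ} (hq : ∀ b ω, 0 ≤ q b ω)
    (hq1 : ∀ b, ∑ ω, q b ω = 1) (hX : ∀ ω, X.p ω = ∑ b, P b * q b ω) (k : ℕ) (n : B → ℕ) :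
    dist (pi fun _ : Fin k => X) (powers (fun b => X.reweight (q b) (hq b) (hq1 b)) n) ≤
      ∑ b, (√k + 1 + |k * P b - n b|) * (X.reweight (q b) (hq b) (hq1 b)).totalEnt +
      2 * Fintype.card I * (k * partEntropy P ⊥) := by
  classical
  set D : B → PartSpace.{v, w} I := fun b => X.reweight (q b) (hq b) (hq1 b) with hD
  have hP' : ∀ x : Fin k → B, 0 ≤ ∏ j, P (x j) := fun x => Finset.prod_nonneg fun j _ => hP _
  -- Slice the power by words x of length k; the slice of x is the product of the components named
  -- by its letters.
  have hslice := dist_le_sum_slices hP' (sum_prod_eq_one fun _ => hP1) (pi fun _ : Fin k => X)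
    (q := fun x ω => ∏ j, q (x j) (ω j)) (fun x ω => Finset.prod_nonneg fun j _ => hq _ _)
    (fun x => (pi fun j => D (x j)).sum_eq_one) (fun ω => by
      change ∏ j, X.p (ω j) = _
      simp only [hX, ← Finset.prod_mul_distrib]
      rw [Finset.prod_univ_sum, Fintype.piFinset_univ]) (powers D n)
  have hent : partEntropy (fun x : Fin k → B => ∏ j, P (x j)) ⊥ = k * partEntropy P ⊥ := by
    rw [← piPart_bot, partEntropy_pi (fun _ => hP) fun _ => hP1]
    simp
  rw [hent] at hslice
  refine hslice.trans (add_le_add_left ?_ _)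
  calc _ ≤ ∑ x : Fin k → B, (∏ j, P (x j)) *
        ∑ b, |((Finset.univ.filter fun j => x j = b).card : ℝ) - n b| * (D b).totalEnt :=
        Finset.sum_le_sum fun x _ =>
          mul_le_mul_of_nonneg_left (dist_pi_comp_powers_le D x n) (hP' x)
    _ = ∑ b, (∑ x : Fin k → B, (∏ j, P (x j)) *
        |((Finset.univ.filter fun j => x j = b).card : ℝ) - n b|) * (D b).totalEnt := by
        simp only [Finset.mul_sum, Finset.sum_mul]
        rw [Finset.sum_comm]
        simp only [mul_assoc]
    _ ≤ _ := by
        refine Finset.sum_le_sum fun b _ => mul_le_mul_of_nonneg_right ?_ (totalEnt_nonneg _)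
        calc _ ≤ ∑ x : Fin k → B, ((∏ j, P (x j)) *
              |((Finset.univ.filter fun j => x j = b).card : ℝ) - k * P b| +
              (∏ j, P (x j)) * |k * P b - n b|) :=
              Finset.sum_le_sum fun x _ => by
                rw [← mul_add]
                exact mul_le_mul_of_nonneg_left (abs_sub_le _ _ _) (hP' x)
          _ ≤ _ := by
              rw [Finset.sum_add_distrib, ← Finset.sum_mul, sum_prod_eq_one fun _ => hP1, one_mul]
              exact add_le_add_left (sum_prod_mul_abs_card_sub_le hP hP1 k b) _

end Slicing

end PartSpace

/-! ### Conditioning -/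

open Classical in
/-- The weights conditioned on the event `U = a`. -/
def condWeight {Ω A : Type*} [Fintype Ω] (p : Ω → ℝ) (U : Ω → A) (a : A) (ω : Ω) : ℝ :=
  -- On a null event the weights stay unconditioned, so that the result is always a probability
  -- distribution.
  if pushWeight U p a = 0 then p ω else if U ω = a then p ω / pushWeight U p a else 0

section CondWeight

variable {Ω A : Type*} [Fintype Ω] {p : Ω → ℝ}

-- After multiplication by the mass of the event the default value disappears; identities for
-- conditioned weights are checked in this form.
open Classical in
theorem pushWeight_mul_condWeight (hp : ∀ ω, 0 ≤ p ω) (U : Ω → A) (a : A) (ω : Ω) :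
    pushWeight U p a * condWeight p U a ω = if U ω = a then p ω else 0 := by
  rw [condWeight]
  by_cases h : pushWeight U p a = 0
  · rw [if_pos h, h, zero_mul]
    split_ifs with h'
    · subst h'
      exact (pushWeight_eq_zero hp h).symm
    · rfl
  · rw [if_neg h]
    split_ifs
    · field_simp
    · simp

theorem condWeight_nonneg (hp : ∀ ω, 0 ≤ p ω) (U : Ω → A) (a : A) (ω : Ω) :
    0 ≤ condWeight p U a ω := by
  rw [condWeight]
  split_ifs
  · exact hp ω
  · exact div_nonneg (hp ω) (pushWeight_nonneg hp U a)
  · exact le_rfl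

theorem sum_condWeight (hp1 : ∑ ω, p ω = 1) (U : Ω → A) (a : A) :
    ∑ ω, condWeight p U a ω = 1 := by
  classical
  by_cases h : pushWeight U p a = 0
  · simp only [condWeight, if_pos h, hp1]
  · simp only [condWeight, if_neg h]
    rw [← div_self h]
    conv_rhs => rw [pushWeight, Finset.sum_div]
    refine Finset.sum_congr rfl fun ω _ => ?_
    change _ = _ / pushWeight U p a
    split_ifs <;> simp

/-- The chain rule H(r | U) = H(U, r) - H(U), applied to the joint law of U and the point, which
disintegrates into the conditioned weights. -/
theorem sum_mul_partEntropy_condWeight [Fintype A] (hp : ∀ ω, 0 ≤ p ω) (hp1 : ∑ ω, p ω = 1)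
    (U : Ω → A) (r : Setoid Ω) :
    ∑ a, pushWeight U p a * partEntropy (condWeight p U a) r =
      partEntropy p ((⊥ : Setoid A).comap U ⊓ r) - partEntropy p ((⊥ : Setoid A).comap U) := by
  classical
  have h := partEntropy_mixture (pushWeight_nonneg hp U) (condWeight_nonneg hp U)
    (sum_condWeight hp1 U) r
  have h1 : (fun z : A × Ω => pushWeight U p z.1 * condWeight p U z.1 z.2) =
      pushWeight (fun ω => (U ω, ω)) p := by
    funext ⟨a, ω⟩
    rw [pushWeight_mul_condWeight hp]
    simp only [pushWeight, Prod.mk.injEq]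
    rw [Finset.sum_eq_single ω]
    · simp
    · intro ω' _ h'
      simp [h']
    · simp
  rw [h1, partEntropy_pushWeight, partEntropy_pushWeight] at h
  change partEntropy p ((⊥ : Setoid A).comap U ⊓ r) = _ at h
  linarith

-- Provides the mixture hypothesis of `dist_powers_mixture_le`: averaging the slices by a finer
-- variable W over the values with `π t = a` gives the slice over a.
open Classical in
theorem sum_mixture_condWeight {Ω' T : Type*} [Fintype T] (hp : ∀ ω, 0 ≤ p ω) (W : Ω → T)
    (π : T → A) (f : Ω → Ω') (U : Ω' → A) (h : ∀ z, π (W z) = U (f z)) (a : A) (ω : Ω') :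
    ∑ t, (if π t = a then pushWeight W p t * pushWeight f (condWeight p W t) ω else 0) =
      if U ω = a then pushWeight f p ω else 0 := by
  have h1 : ∀ t, pushWeight W p t * pushWeight f (condWeight p W t) ω =
      ∑ z, if f z = ω then (if W z = t then p z else 0) else 0 := by
    intro t
    rw [pushWeight, pushWeight, Finset.mul_sum]
    refine Finset.sum_congr rfl fun z _ => ?_
    by_cases hz : f z = ω
    · rw [if_pos hz, if_pos hz]
      exact pushWeight_mul_condWeight hp W t z
    · rw [if_neg hz, if_neg hz, mul_zero]
  calc _ = ∑ t, ∑ z, if W z = t then (if f z = ω then (if π t = a then p z else 0) else 0)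
        else 0 := by
        refine Finset.sum_congr rfl fun t _ => ?_
        rw [h1]
        split_ifs with h2
        · refine Finset.sum_congr rfl fun z _ => ?_
          split_ifs <;> rfl
        · simp
    _ = ∑ z, if f z = ω then (if U ω = a then p z else 0) else 0 := by
        rw [Finset.sum_comm]
        refine Finset.sum_congr rfl fun z _ => ?_
        rw [Finset.sum_ite_eq, if_pos (Finset.mem_univ _)]
        by_cases hz : f z = ω
        · rw [if_pos hz, if_pos hz, h, hz]
        · rw [if_neg hz, if_neg hz]
    _ = _ := by
        rw [pushWeight]
        split_ifs <;> simp

end CondWeight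

namespace PartSpace

/-! ### Comparing the two families of conditioned spaces through a coupling -/

section Mixture

variable {I : Type v} [Fintype I]

open Classical in
/-- Products of powers of mixtures, compared with products of powers of the components. -/
theorem dist_powers_mixture_le {A T : Type*} [Fintype A] [Fintype T] (X : PartSpace.{v, w} I)
    {P : A → ℝ} (hP : ∀ a, 0 < P a) {r : A → X.Ω → ℝ} (hr : ∀ a ω, 0 ≤ r a ω)
    (hr1 : ∀ a, ∑ ω, r a ω = 1) {Q : T → ℝ} (hQ : ∀ t, 0 ≤ Q t) (hQ1 : ∑ t, Q t = 1)
    {q : T → X.Ω → ℝ} (hq : ∀ t ω, 0 ≤ q t ω) (hq1 : ∀ t, ∑ ω, q t ω = 1) (π : T → A)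
    (hPQ : pushWeight π Q = P)
    (hmix : ∀ a ω, P a * r a ω = ∑ t, if π t = a then Q t * q t ω else 0) (m : ℕ) :
    dist (powers (fun a => X.reweight (r a) (hr a) (hr1 a)) fun a => ⌊P a * m⌋₊)
      (powers (fun t => X.reweight (q t) (hq t) (hq1 t)) fun t => ⌊Q t * m⌋₊) ≤
      2 * Fintype.card I * (m * (partEntropy Q ⊥ - partEntropy P ⊥)) +
        (√m + 1) * (2 * Fintype.card A *
          ∑ t, (X.reweight (q t) (hq t) (hq1 t)).totalEnt) := by
  set D := fun a => X.reweight (r a) (hr a) (hr1 a)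
  set E := fun t => X.reweight (q t) (hq t) (hq1 t)
  set n : A → T → ℕ := fun a t => if π t = a then ⌊Q t * m⌋₊ else 0 with hn
  have hnsum : (fun t => ⌊Q t * m⌋₊) = fun t => ∑ a, n a t := by
    funext t
    simp [hn]
  have hP1 : ∑ a, P a = 1 := by rw [← hPQ, sum_pushWeight, hQ1]
  -- The conditional law of t given a; the a-th component is the mixture of the q t with these
  -- weights.
  set c : A → T → ℝ := fun a t => if π t = a then Q t / P a else 0 with hc
  have hPc : ∀ a t, P a * c a t = if π t = a then Q t else 0 := fun a t => by
    simp only [hc]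
    split_ifs
    · rw [mul_div_cancel₀ _ (hP a).ne']
    · simp
  have hc0 : ∀ a t, 0 ≤ c a t := fun a t => by
    simp only [hc]
    split_ifs
    · exact div_nonneg (hQ t) (hP a).le
    · exact le_rfl
  have hc1 : ∀ a, ∑ t, c a t = 1 := fun a => by
    refine mul_left_cancel₀ (hP a).ne' ?_
    rw [Finset.mul_sum, mul_one, Finset.sum_congr rfl fun t _ => hPc a t]
    conv_rhs => rw [← hPQ]
    rfl
  have hcle : ∀ a t, c a t ≤ 1 := fun a t =>
    hc1 a ▸ Finset.single_le_sum (fun t _ => hc0 a t) (Finset.mem_univ t)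
  have hPle : ∀ a, P a ≤ 1 := fun a =>
    hP1 ▸ Finset.single_le_sum (fun a _ => (hP a).le) (Finset.mem_univ a)
  have hDmix : ∀ a ω, (D a).p ω = ∑ t, c a t * q t ω := fun a ω => by
    refine mul_left_cancel₀ (hP a).ne' ?_
    rw [Finset.mul_sum]
    refine (hmix a ω).trans (Finset.sum_congr rfl fun t _ => ?_)
    rw [← mul_assoc, hPc]
    split_ifs <;> simp
  have hslice : ∀ a, dist (pi fun _ : Fin ⌊P a * m⌋₊ => D a) (powers E (n a)) ≤
      ∑ t, (√m + 1) * 2 * (E t).totalEnt +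
        2 * Fintype.card I * (m * (P a * partEntropy (c a) ⊥)) := by
    intro a
    refine (dist_pi_mixture_powers_le (hc0 a) (hc1 a) (D a) hq hq1 (hDmix a) _ (n a)).trans ?_
    have hk : (⌊P a * m⌋₊ : ℝ) ≤ P a * m :=
      Nat.floor_le (mul_nonneg (hP a).le (Nat.cast_nonneg m))
    have hk' : P a * m < ⌊P a * m⌋₊ + 1 := Nat.lt_floor_add_one _
    have hkm : (⌊P a * m⌋₊ : ℝ) ≤ m :=
      hk.trans (mul_le_of_le_one_left (Nat.cast_nonneg m) (hPle a))
    refine add_le_add (Finset.sum_le_sum fun t _ =>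
      mul_le_mul_of_nonneg_right ?_ (totalEnt_nonneg _)) ?_
    · have h1 : √(⌊P a * m⌋₊ : ℝ) ≤ √m := Real.sqrt_le_sqrt hkm
      -- When `π t = a`, both numbers lie between Q t * m - 1 and Q t * m, because `c a t ≤ 1`.
      have h2 : |(⌊P a * m⌋₊ : ℝ) * c a t - n a t| ≤ 1 := by
        by_cases ht : π t = a
        · have h3 : (n a t : ℝ) = ⌊Q t * m⌋₊ := by simp [hn, ht]
          have h4 : P a * c a t = Q t := by rw [hPc, if_pos ht]
          have h5 : (⌊Q t * m⌋₊ : ℝ) ≤ Q t * m :=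
            Nat.floor_le (mul_nonneg (hQ t) (Nat.cast_nonneg m))
          have h6 : Q t * m < ⌊Q t * m⌋₊ + 1 := Nat.lt_floor_add_one _
          have h7 := mul_le_mul_of_nonneg_right hk (hc0 a t)
          have h8 := mul_le_mul_of_nonneg_right hk'.le (hc0 a t)
          have h9 : P a * m * c a t = Q t * m := by rw [← h4]; ring
          rw [h3, abs_le]
          constructor <;> linarith [hcle a t]
        · simp [hn, hc, ht]
      linarith [Real.sqrt_nonneg (m : ℝ)]
    · rw [← mul_assoc (m : ℝ), mul_comm (m : ℝ)]
      exact mul_le_mul_of_nonneg_left (mul_le_mul_of_nonneg_right hk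
        (partEntropy_nonneg (hc0 a) (hc1 a) _)) (by positivity)
  -- The chain rule: as t determines a, the joint entropy of (a, t) is the entropy of Q.
  have hent : ∑ a, P a * partEntropy (c a) ⊥ = partEntropy Q ⊥ - partEntropy P ⊥ := by
    have h := partEntropy_mixture (fun a => (hP a).le) hc0 hc1 ⊥
    have h1 : (fun z : A × T => P z.1 * c z.1 z.2) = pushWeight (fun t => (π t, t)) Q := by
      funext ⟨a, t⟩
      rw [hPc]
      simp only [pushWeight, Prod.mk.injEq]
      rw [Finset.sum_eq_single t]
      · simp
      · intro t' _ h'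
        simp [h']
      · simp
    have h2 : ((⊥ : Setoid A).comap Prod.fst ⊓ (⊥ : Setoid T).comap Prod.snd).comap
        (fun t => (π t, t)) = ⊥ := by
      ext t t'
      exact ⟨fun h => h.2, fun h => ⟨congrArg π h, h⟩⟩
    rw [h1, partEntropy_pushWeight, h2] at h
    linarith
  have hD : dist (pi fun a => pi fun _ : Fin ⌊P a * m⌋₊ => D a)
      (powers D fun a => ⌊P a * m⌋₊) = 0 := dist_pi_sigma fun a (_ : Fin ⌊P a * m⌋₊) => D a
  rw [hnsum, ← dist_congr hD (dist_pi_powers E n)]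
  refine (dist_pi_le _ _).trans ((Finset.sum_le_sum fun a _ => hslice a).trans (le_of_eq ?_))
  simp only [Finset.sum_add_distrib, ← Finset.mul_sum, hent, Finset.sum_const,
    Finset.card_univ, nsmul_eq_mul]
  ring

/-- The space conditioned on the event `U = a`. -/
def cond {I : Type v} {A : Type*} (X : PartSpace.{v, w} I) (U : X.Ω → A) (a : A) :
    PartSpace.{v, w} I :=
  X.reweight (condWeight X.p U a) (condWeight_nonneg X.nonneg U a) (sum_condWeight X.sum_eq_one U a)

variable {X : PartSpace.{v, w} I} {Y : PartSpace.{v, u} I}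

theorem sum_pushWeight_condWeight {I : Type v} {X : PartSpace.{v, w} I}
    {Y : PartSpace.{v, u} I} (K : Coupling X Y) {T Ω' : Type*} [Fintype Ω']
    (W : X.Ω × Y.Ω → T) (f : X.Ω × Y.Ω → Ω') (t : T) :
    ∑ ω, pushWeight f (condWeight K.q W t) ω = 1 := by
  rw [sum_pushWeight, sum_condWeight K.sum_eq_one]

/-- The conditioned coupling. -/
def Coupling.cond (K : Coupling X Y) {T : Type*} (W : X.Ω × Y.Ω → T) (t : T) :
    Coupling (X.reweight (pushWeight Prod.fst (condWeight K.q W t))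
      (pushWeight_nonneg (condWeight_nonneg K.nonneg W t) _) (sum_pushWeight_condWeight K W _ t))
      (Y.reweight (pushWeight Prod.snd (condWeight K.q W t))
      (pushWeight_nonneg (condWeight_nonneg K.nonneg W t) _)
      (sum_pushWeight_condWeight K W _ t)) where
  q := condWeight K.q W t
  nonneg := condWeight_nonneg K.nonneg W t
  fst := rfl
  snd := rfl

/-- Each summand is a sum of two conditional entropies, of the joint partition given one marginal
partition, and these decrease under further conditioning on W. -/
theorem sum_mul_cost_cond_le (K : Coupling X Y) {T : Type*} [Fintype T] (W : X.Ω × Y.Ω → T) :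
    ∑ t, pushWeight W K.q t * (K.cond W t).cost ≤ K.cost := by
  simp only [Coupling.cost, Finset.mul_sum]
  rw [Finset.sum_comm]
  refine Finset.sum_le_sum fun i _ => ?_
  have h1 : ∀ t, (X.reweight (pushWeight Prod.fst (condWeight K.q W t))
      (pushWeight_nonneg (condWeight_nonneg K.nonneg W t) _)
      (sum_pushWeight_condWeight K W _ t)).ent i =
      partEntropy (condWeight K.q W t) ((X.part i).comap Prod.fst) := fun t =>
    partEntropy_pushWeight _ _ _
  have h2 : ∀ t, (Y.reweight (pushWeight Prod.snd (condWeight K.q W t))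
      (pushWeight_nonneg (condWeight_nonneg K.nonneg W t) _)
      (sum_pushWeight_condWeight K W _ t)).ent i =
      partEntropy (condWeight K.q W t) ((Y.part i).comap Prod.snd) := fun t =>
    partEntropy_pushWeight _ _ _
  have h3 : ∀ t, partEntropy (K.cond W t).q ((K.cond W t).joint i) =
      partEntropy (condWeight K.q W t) (K.joint i) := fun t => rfl
  simp only [h1, h2, h3, mul_sub, Finset.sum_sub_distrib, mul_left_comm _ (2 : ℝ),
    ← Finset.mul_sum, sum_mul_partEntropy_condWeight K.nonneg K.sum_eq_one]
  -- Used for both marginals; the entropy of W itself enters with total coefficient 2 - 1 - 1 = 0.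
  have key : ∀ r : Setoid (X.Ω × Y.Ω), K.joint i ≤ r →
      partEntropy K.q ((⊥ : Setoid T).comap W ⊓ K.joint i) + partEntropy K.q r ≤
      partEntropy K.q (K.joint i) + partEntropy K.q ((⊥ : Setoid T).comap W ⊓ r) := by
    intro r hr
    have := partEntropy_submodular K.nonneg K.sum_eq_one (K.joint i) ((⊥ : Setoid T).comap W) r
    rwa [inf_comm (K.joint i), inf_assoc, inf_eq_left.2 hr] at this
  have k1 := key _ (inf_le_left : K.joint i ≤ (X.part i).comap Prod.fst)
  have k2 := key _ (inf_le_right : K.joint i ≤ (Y.part i).comap Prod.snd)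
  rw [K.ent_fst, K.ent_snd]
  linarith

/-- The path goes from slices over U to slices over (U, V) on the X side, then across the
conditioned couplings to the Y side, then back to slices over V. -/
theorem exists_dist_powers_cond_le {A B : Type*} [Fintype A] [Fintype B] (K : Coupling X Y)
    (ι : I) {U : X.Ω → A} {V : Y.Ω → B} (hU : X.part ι = (⊥ : Setoid A).comap U)
    (hV : Y.part ι = (⊥ : Setoid B).comap V) (hU0 : ∀ a, 0 < pushWeight U X.p a)
    (hV0 : ∀ b, 0 < pushWeight V Y.p b) :
    ∃ C : ℝ, ∀ m : ℕ,
      dist (powers (X.cond U) fun a => ⌊pushWeight U X.p a * m⌋₊)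
      (powers (Y.cond V) fun b => ⌊pushWeight V Y.p b * m⌋₊) ≤
      (2 * Fintype.card I + 1) * K.cost * m + C * (√m + 1) := by
  classical
  set W : X.Ω × Y.Ω → A × B := fun z => (U z.1, V z.2) with hW
  set Q : A × B → ℝ := pushWeight W K.q with hQ
  have hQ0 : ∀ t, 0 ≤ Q t := pushWeight_nonneg K.nonneg W
  have hQ1 : ∑ t, Q t = 1 := by rw [hQ, sum_pushWeight, K.sum_eq_one]
  have hPQ : pushWeight Prod.fst Q = pushWeight U X.p := by
    rw [hQ, ← K.fst, pushWeight_comp, pushWeight_comp]; rfl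
  have hPQ' : pushWeight Prod.snd Q = pushWeight V Y.p := by
    rw [hQ, ← K.snd, pushWeight_comp, pushWeight_comp]; rfl
  have hX := fun m => dist_powers_mixture_le X hU0 (condWeight_nonneg X.nonneg U)
    (sum_condWeight X.sum_eq_one U) hQ0 hQ1
    (fun t => pushWeight_nonneg (condWeight_nonneg K.nonneg W t) Prod.fst)
    (sum_pushWeight_condWeight K W Prod.fst) Prod.fst hPQ (fun a ω => by
      rw [pushWeight_mul_condWeight X.nonneg,
        sum_mixture_condWeight K.nonneg W Prod.fst Prod.fst U (fun z => rfl), K.fst]) m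
  have hY := fun m => dist_powers_mixture_le Y hV0 (condWeight_nonneg Y.nonneg V)
    (sum_condWeight Y.sum_eq_one V) hQ0 hQ1
    (fun t => pushWeight_nonneg (condWeight_nonneg K.nonneg W t) Prod.snd)
    (sum_pushWeight_condWeight K W Prod.snd) Prod.snd hPQ' (fun a ω => by
      rw [pushWeight_mul_condWeight Y.nonneg,
        sum_mixture_condWeight K.nonneg W Prod.snd Prod.snd V (fun z => rfl), K.snd]) m
  have hXY : ∀ m : ℕ, dist
      (powers (fun t => X.reweight (pushWeight Prod.fst (condWeight K.q W t))
        (pushWeight_nonneg (condWeight_nonneg K.nonneg W t) _)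
        (sum_pushWeight_condWeight K W _ t)) fun t => ⌊Q t * m⌋₊)
      (powers (fun t => Y.reweight (pushWeight Prod.snd (condWeight K.q W t))
        (pushWeight_nonneg (condWeight_nonneg K.nonneg W t) _)
        (sum_pushWeight_condWeight K W _ t)) fun t => ⌊Q t * m⌋₊) ≤ K.cost * m := by
    intro m
    refine (dist_powers_congr _ _ _).trans (le_trans (Finset.sum_le_sum fun t _ =>
      mul_le_mul (Nat.floor_le (mul_nonneg (hQ0 t) (Nat.cast_nonneg m)))
        (dist_le_cost (K.cond W t)) (dist_nonneg _ _)
        (mul_nonneg (hQ0 t) (Nat.cast_nonneg m))) ?_)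
    simp only [mul_right_comm _ (m : ℝ), ← Finset.sum_mul]
    exact mul_le_mul_of_nonneg_right (sum_mul_cost_cond_le K W) (Nat.cast_nonneg m)
  have hentX : partEntropy (pushWeight U X.p) ⊥ = X.ent ι := by
    rw [partEntropy_pushWeight, ← hU, ent]
  have hentY : partEntropy (pushWeight V Y.p) ⊥ = Y.ent ι := by
    rw [partEntropy_pushWeight, ← hV, ent]
  have hentQ : partEntropy Q ⊥ = partEntropy K.q (K.joint ι) := by
    rw [hQ, partEntropy_pushWeight, Coupling.joint, hU, hV]
    congr 1
    ext z z'
    exact ⟨fun h => ⟨congrArg Prod.fst h, congrArg Prod.snd h⟩, fun h => Prod.ext h.1 h.2⟩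
  rw [hentX, hentQ] at hX
  rw [hentY, hentQ] at hY
  -- The two passages to finer slices together cost 2|I| m times this single summand, up to O(√m).
  have hcost : 2 * partEntropy K.q (K.joint ι) - X.ent ι - Y.ent ι ≤ K.cost :=
    Finset.single_le_sum (f := fun i => 2 * partEntropy K.q (K.joint i) - X.ent i - Y.ent i)
      (fun i _ => K.cost_summand_nonneg i) (Finset.mem_univ ι)
  obtain ⟨C₁, hX'⟩ : ∃ C₁ : ℝ, ∀ m : ℕ,
      dist (powers (X.cond U) fun a => ⌊pushWeight U X.p a * m⌋₊)
      (powers (fun t => X.reweight (pushWeight Prod.fst (condWeight K.q W t))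
        (pushWeight_nonneg (condWeight_nonneg K.nonneg W t) _)
        (sum_pushWeight_condWeight K W _ t)) fun t => ⌊Q t * m⌋₊) ≤
      2 * Fintype.card I * (m * (partEntropy K.q (K.joint ι) - X.ent ι)) + (√m + 1) * C₁ :=
    ⟨_, hX⟩
  obtain ⟨C₂, hY'⟩ : ∃ C₂ : ℝ, ∀ m : ℕ,
      dist (powers (Y.cond V) fun a => ⌊pushWeight V Y.p a * m⌋₊)
      (powers (fun t => Y.reweight (pushWeight Prod.snd (condWeight K.q W t))
        (pushWeight_nonneg (condWeight_nonneg K.nonneg W t) _)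
        (sum_pushWeight_condWeight K W _ t)) fun t => ⌊Q t * m⌋₊) ≤
      2 * Fintype.card I * (m * (partEntropy K.q (K.joint ι) - Y.ent ι)) + (√m + 1) * C₂ :=
    ⟨_, hY⟩
  refine ⟨C₁ + C₂, fun m => ?_⟩
  have h5 := mul_le_mul_of_nonneg_left (mul_le_mul_of_nonneg_left hcost
    (Nat.cast_nonneg (α := ℝ) m)) (by positivity : (0 : ℝ) ≤ 2 * Fintype.card I)
  refine (dist_triangle _ _ _).trans ((add_le_add (hX' m) ((dist_triangle _ _ _).trans
    (add_le_add (hXY m) ((dist_comm _ _).le.trans (hY' m))))).trans ?_)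
  linarith

end Mixture

end PartSpace

/-! ### Existence of limits and rescaling -/

/-- Fekete's lemma for sequences that are subadditive up to a constant. -/
theorem exists_tendsto_div_of_almost_subadditive {s : ℕ → ℝ} (h0 : ∀ n, 0 ≤ s n) {C : ℝ}
    (hs : ∀ n m, s (n + m) ≤ s n + s m + C) : ∃ L, Tendsto (fun n : ℕ => s n / n) atTop (𝓝 L) := by
  have hsub : Subadditive fun n => s n + C := fun n m => by linarith [hs n m]
  have hbdd : BddBelow (Set.range fun n : ℕ => (s n + C) / n) := by
    refine ⟨-|C|, ?_⟩
    rintro _ ⟨n, rfl⟩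
    rcases Nat.eq_zero_or_pos n with rfl | hn
    · simp
    · have h1 : (1 : ℝ) ≤ n := by exact_mod_cast hn
      change _ ≤ (s n + C) / n
      rw [le_div_iff₀ (by linarith)]
      nlinarith [h0 n, neg_abs_le C, abs_nonneg C]
  refine ⟨hsub.lim - 0, ?_⟩
  refine ((hsub.tendsto_lim hbdd).sub (tendsto_const_div_atTop_nhds_zero_nat C)).congr fun n => ?_
  ring

namespace PartSpace

section Scaling

variable {I : Type v} [Fintype I] {X : PartSpace.{v, w} I} {Y : PartSpace.{v, u} I}

/-- A map applied in each coordinate of a power. -/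
def powMap {I : Type v} {A : Type*} {X : PartSpace.{v, w} I} (U : X.Ω → A) (N : ℕ) :
    (pi fun _ : Fin N => X).Ω → Fin N → A :=
  fun ω j => U (ω j)

theorem pushWeight_powMap {I : Type v} {A : Type*} (X : PartSpace.{v, w} I) (U : X.Ω → A) (N : ℕ) :
    pushWeight (powMap U N) (pi fun _ : Fin N => X).p =
      fun x => ∏ j, pushWeight U X.p (x j) := by
  exact @pushWeight_pi (Fin N) _ (Classical.decEq _) _ _ _ (fun _ => X.p) fun _ => U

/-- Coordinates of a power are independent, so conditioning on all values of U factors over the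
coordinates. -/
theorem dist_cond_pi {A : Type*} {U : X.Ω → A} (hU0 : ∀ a, 0 < pushWeight U X.p a) (N : ℕ)
    (x : Fin N → A) :
    dist ((pi fun _ : Fin N => X).cond (powMap U N) x)
      (pi fun j => X.cond U (x j)) = 0 := by
  classical
  refine dist_eq_zero_of_map id ((pushWeight_id _).trans ?_) fun i => rfl
  refine funext fun (ω : Fin N → X.Ω) => ?_
  have hpos : 0 < ∏ j, pushWeight U X.p (x j) := Finset.prod_pos fun j _ => hU0 (x j)
  refine mul_left_cancel₀ hpos.ne' ?_
  have h := pushWeight_mul_condWeight (pi fun _ : Fin N => X).nonneg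
    (powMap U N) x ω
  rw [pushWeight_powMap] at h
  refine h.trans ?_
  change _ = _ * ∏ j, condWeight X.p U (x j) (ω j)
  rw [← Finset.prod_mul_distrib]
  by_cases hx : powMap U N ω = x
  · rw [if_pos hx]
    change ∏ j, X.p (ω j) = _
    refine Finset.prod_congr rfl fun j _ => ?_
    rw [pushWeight_mul_condWeight X.nonneg, if_pos (show U (ω j) = x j from congrFun hx j)]
  · rw [if_neg hx]
    obtain ⟨j, hj⟩ := Function.ne_iff.1 hx
    refine (Finset.prod_eq_zero (Finset.mem_univ j) ?_).symm
    rw [pushWeight_mul_condWeight X.nonneg, if_neg (show ¬U (ω j) = x j from hj)]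

/-- Slices of the N-th power are products of slices of X, so only the multiplicities need
comparison. Before rounding both sides contain N * m * P a copies of the a-th slice; rounding errors
are bounded independently of m. -/
theorem exists_dist_powers_scale_le {A : Type*} [Fintype A] {U : X.Ω → A}
    (hU0 : ∀ a, 0 < pushWeight U X.p a) (N : ℕ) :
    ∃ C : ℝ, ∀ m : ℕ,
      dist (powers ((pi fun _ : Fin N => X).cond (powMap U N))
        fun x => ⌊pushWeight (powMap U N) (pi fun _ : Fin N => X).p x * m⌋₊)
      (powers (X.cond U) fun a => ⌊pushWeight U X.p a * (N * m : ℕ)⌋₊) ≤ C := by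
  classical
  rw [pushWeight_powMap]
  set P := pushWeight U X.p with hP
  have hP1 : ∑ a, P a = 1 := by rw [hP, sum_pushWeight, X.sum_eq_one]
  set cnt : (Fin N → A) → A → ℕ := fun x a => (Finset.univ.filter fun j => x j = a).card with hcnt
  refine ⟨∑ a, (∑ x, (cnt x a : ℝ) + 1) * (X.cond U a).totalEnt, fun m => ?_⟩
  set n : (Fin N → A) → ℕ := fun x => ⌊(∏ j, P (x j)) * m⌋₊ with hn
  have h1 : dist (powers ((pi fun _ : Fin N => X).cond (powMap U N)) n)
      (powers (fun x => powers (X.cond U) (cnt x)) n) = 0 := by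
    refine le_antisymm ((dist_powers_congr _ _ _).trans (le_of_eq ?_)) (dist_nonneg _ _)
    refine Finset.sum_eq_zero fun x _ => ?_
    rw [dist_congr_left (dist_cond_pi hU0 N x)]
    exact mul_eq_zero_of_right _ (dist_pi_comp_powers (X.cond U) x)
  have h2 : dist (powers (fun x => powers (X.cond U) (cnt x)) n)
      (powers (X.cond U) fun a => ∑ x, n x * cnt x a) = 0 := by
    have := dist_pi_powers (X.cond U) fun z : Σ x, Fin (n x) => cnt z.1
    have h3 : ∀ a, ∑ z : Σ x, Fin (n x), cnt z.1 a = ∑ x, n x * cnt x a := fun a => by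
      simp [Fintype.sum_sigma]
    simp only [h3] at this
    exact this
  rw [dist_congr_left h1, dist_congr_left h2]
  refine (dist_powers_le _ _ _).trans (Finset.sum_le_sum fun a _ =>
    mul_le_mul_of_nonneg_right ?_ (totalEnt_nonneg _))
  -- The expected number of occurrences of the letter a in a random word of length N.
  have hmean : ∑ x : Fin N → A, (∏ j, P (x j)) * (cnt x a : ℝ) = N * P a := by
    have h3 : ∀ x : Fin N → A, (∏ j, P (x j)) * (cnt x a : ℝ) =
        ∑ j, (∏ j, P (x j)) * if x j = a then 1 else 0 := fun x => by
      rw [← Finset.mul_sum]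
      simp [hcnt]
    rw [Finset.sum_congr rfl fun x _ => h3 x, Finset.sum_comm]
    have h4 : ∀ j : Fin N, ∑ x : Fin N → A, (∏ j, P (x j)) * (if x j = a then 1 else 0) = P a :=
      fun j => by
        have := sum_prod_mul_single (p := fun _ : Fin N => P) (fun _ => hP1) j
          fun b => if b = a then 1 else 0
        simpa using this
    exact (Finset.sum_congr rfl fun j _ => h4 j).trans (by simp)
  have hP0 : ∀ x : Fin N → A, 0 ≤ (∏ j, P (x j)) * m := fun x =>
    mul_nonneg (Finset.prod_nonneg fun j _ => (hU0 (x j)).le) (Nat.cast_nonneg m)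
  have hlow : ∑ x, ((∏ j, P (x j)) * m - 1) * (cnt x a : ℝ) ≤ ∑ x, (n x : ℝ) * cnt x a :=
    Finset.sum_le_sum fun x _ => mul_le_mul_of_nonneg_right
      (Nat.sub_one_lt_floor _).le (Nat.cast_nonneg _)
  have hupp : ∑ x, (n x : ℝ) * cnt x a ≤ ∑ x, ((∏ j, P (x j)) * m) * (cnt x a : ℝ) :=
    Finset.sum_le_sum fun x _ => mul_le_mul_of_nonneg_right
      (Nat.floor_le (hP0 x)) (Nat.cast_nonneg _)
  have hmean' : ∑ x : Fin N → A, ((∏ j, P (x j)) * m) * (cnt x a : ℝ) = N * P a * m := by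
    rw [← hmean, Finset.sum_mul]
    exact Finset.sum_congr rfl fun x _ => by ring
  simp only [sub_mul, one_mul, Finset.sum_sub_distrib] at hlow
  rw [hmean'] at hlow hupp
  have h5 : (⌊P a * (N * m : ℕ)⌋₊ : ℝ) ≤ P a * (N * m : ℕ) :=
    Nat.floor_le (mul_nonneg (hU0 a).le (Nat.cast_nonneg _))
  have h6 : P a * (N * m : ℕ) < (⌊P a * (N * m : ℕ)⌋₊ : ℝ) + 1 := Nat.lt_floor_add_one _
  have h7 : P a * (N * m : ℕ) = N * P a * m := by push_cast; ring
  have h8 : (0 : ℝ) ≤ ∑ x, (cnt x a : ℝ) := Finset.sum_nonneg fun x _ => Nat.cast_nonneg _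
  rw [h7] at h5 h6
  rw [h7]
  push_cast
  rw [abs_le]
  constructor <;> linarith

/-- The distance of the `n`-th terms of the two conditioned sequences. -/
def condDist {A B : Type*} [Fintype A] [Fintype B] (X : PartSpace.{v, w} I)
    (Y : PartSpace.{v, u} I) (U : X.Ω → A) (V : Y.Ω → B) (n : ℕ) : ℝ :=
  dist (powers (X.cond U) fun a => ⌊pushWeight U X.p a * n⌋₊)
    (powers (Y.cond V) fun b => ⌊pushWeight V Y.p b * n⌋₊)

/-- The floor of a sum of nonnegative numbers exceeds the sum of the floors by 0 or 1, so at most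
one copy of each factor is gained. -/
theorem dist_powers_floor_add_le {T : Type*} [Fintype T] (D : T → PartSpace.{v, w} I)
    {P : T → ℝ} (hP : ∀ t, 0 ≤ P t) (n m : ℕ) :
    dist (powers D fun t => ⌊P t * (n + m : ℕ)⌋₊)
      (powers D ((fun t => ⌊P t * n⌋₊) + fun t => ⌊P t * m⌋₊)) ≤ ∑ t, (D t).totalEnt := by
  refine (dist_powers_le _ _ _).trans (Finset.sum_le_sum fun t _ =>
    mul_le_of_le_one_left (totalEnt_nonneg _) ?_)
  have h1 := Nat.floor_le (mul_nonneg (hP t) (Nat.cast_nonneg (n + m)))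
  have h2 := Nat.floor_le (mul_nonneg (hP t) (Nat.cast_nonneg n))
  have h3 := Nat.floor_le (mul_nonneg (hP t) (Nat.cast_nonneg m))
  have h1' := Nat.lt_floor_add_one (P t * (n + m : ℕ))
  have h2' := Nat.lt_floor_add_one (P t * n)
  have h3' := Nat.lt_floor_add_one (P t * m)
  have h4 : ⌊P t * n⌋₊ + ⌊P t * m⌋₊ ≤ ⌊P t * (n + m : ℕ)⌋₊ := by
    refine Nat.le_floor ?_
    push_cast at h2 h3 ⊢
    linarith
  have h5 : ⌊P t * (n + m : ℕ)⌋₊ < ⌊P t * n⌋₊ + ⌊P t * m⌋₊ + 2 := by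
    rw [Nat.floor_lt (mul_nonneg (hP t) (Nat.cast_nonneg _))]
    push_cast at h2' h3' ⊢
    linarith
  have h6 : (⌊P t * (n + m : ℕ)⌋₊ : ℝ) ≤ ⌊P t * n⌋₊ + ⌊P t * m⌋₊ + 1 := by
    exact_mod_cast Nat.lt_succ_iff.1 h5
  have h7 : (⌊P t * n⌋₊ : ℝ) + ⌊P t * m⌋₊ ≤ ⌊P t * (n + m : ℕ)⌋₊ := by
    exact_mod_cast h4
  rw [Pi.add_apply, abs_le]
  push_cast at h6 h7 ⊢
  constructor <;> linarith

theorem exists_tendsto_condDist {A B : Type*} [Fintype A] [Fintype B] (U : X.Ω → A)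
    (V : Y.Ω → B) : ∃ L, Tendsto (fun n : ℕ => condDist X Y U V n / n) atTop (𝓝 L) := by
  refine exists_tendsto_div_of_almost_subadditive (fun n => dist_nonneg _ _)
    (C := ∑ a, (X.cond U a).totalEnt + ∑ b, (Y.cond V b).totalEnt) fun n m => ?_
  have h1 := dist_powers_floor_add_le (X.cond U) (pushWeight_nonneg X.nonneg U) n m
  have h2 := dist_powers_floor_add_le (Y.cond V) (pushWeight_nonneg Y.nonneg V) n m
  have h3 := abs_dist_sub_dist_le _ _ _ _ |>.trans (add_le_add h1 h2)
  have h4 := dist_powers_add_le (X.cond U) (Y.cond V) (fun a => ⌊pushWeight U X.p a * n⌋₊)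
    (fun a => ⌊pushWeight U X.p a * m⌋₊) (fun b => ⌊pushWeight V Y.p b * n⌋₊)
    (fun b => ⌊pushWeight V Y.p b * m⌋₊)
  have h5 := (abs_le.1 h3).2
  rw [condDist, condDist, condDist]
  linarith

/-- Apply `exists_dist_powers_cond_le` to a near-optimal coupling of the N-th powers, pass to the
subsequence N * m, and divide by m: the √m and constant errors disappear. -/
theorem mul_lim_condDist_le {A B : Type*} [Fintype A] [Fintype B] (ι : I) {U : X.Ω → A}
    {V : Y.Ω → B} (hU : X.part ι = (⊥ : Setoid A).comap U) (hV : Y.part ι = (⊥ : Setoid B).comap V)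
    (hU0 : ∀ a, 0 < pushWeight U X.p a) (hV0 : ∀ b, 0 < pushWeight V Y.p b) {L : ℝ}
    (hL : Tendsto (fun n : ℕ => condDist X Y U V n / n) atTop (𝓝 L)) {N : ℕ} (hN : 0 < N) :
    N * L ≤ (2 * Fintype.card I + 1) * dist (pi fun _ : Fin N => X) (pi fun _ : Fin N => Y) := by
  classical
  refine le_of_forall_pos_le_add fun ε hε => ?_
  obtain ⟨K, hK⟩ := exists_cost_lt (pi fun _ : Fin N => X) (pi fun _ : Fin N => Y)
    (div_pos hε (by positivity : (0 : ℝ) < 2 * Fintype.card I + 1))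
  obtain ⟨C, hC⟩ := exists_dist_powers_cond_le K ι
    (U := powMap U N) (V := powMap V N)
    (by
      ext x y
      change (∀ j, X.part ι (x j) (y j)) ↔ (fun j => U (x j)) = fun j => U (y j)
      rw [hU, funext_iff]
      rfl)
    (by
      ext x y
      change (∀ j, Y.part ι (x j) (y j)) ↔ (fun j => V (x j)) = fun j => V (y j)
      rw [hV, funext_iff]
      rfl)
    (fun x => by
      rw [pushWeight_powMap]
      exact Finset.prod_pos fun j _ => hU0 _)
    (fun x => by
      rw [pushWeight_powMap]
      exact Finset.prod_pos fun j _ => hV0 _)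
  obtain ⟨C₁, hC₁⟩ := exists_dist_powers_scale_le hU0 N
  obtain ⟨C₂, hC₂⟩ := exists_dist_powers_scale_le hV0 N
  have hle : ∀ m : ℕ, condDist X Y U V (N * m) ≤
      (2 * Fintype.card I + 1) * K.cost * m + (|C| * (√m + 1) + (C₁ + C₂)) := by
    intro m
    have h1 := (abs_le.1 ((abs_dist_sub_dist_le _ _ _ _).trans (add_le_add (hC₁ m) (hC₂ m)))).1
    have h2 := hC m
    have h3 := mul_le_mul_of_nonneg_right (le_abs_self C) (by positivity : (0 : ℝ) ≤ √m + 1)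
    rw [condDist]
    linarith
  have hlim1 : Tendsto (fun m : ℕ => (N : ℝ) * (condDist X Y U V (N * m) / (N * m : ℕ))) atTop
      (𝓝 (N * L)) :=
    (hL.comp (tendsto_id.const_mul_atTop' hN)).const_mul _
  have hsq : Tendsto (fun m : ℕ => √(m : ℝ) / m) atTop (𝓝 0) := by
    have h1 : Tendsto (fun m : ℕ => (√(m : ℝ))⁻¹) atTop (𝓝 0) :=
      tendsto_inv_atTop_zero.comp (Real.tendsto_sqrt_atTop.comp tendsto_natCast_atTop_atTop)
    refine h1.congr fun m => ?_
    rw [Real.sqrt_div_self', one_div]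
  have hlim2 : Tendsto (fun m : ℕ => (2 * Fintype.card I + 1) * K.cost +
      (|C| * (√(m : ℝ) / m) + (|C| + (C₁ + C₂)) / m)) atTop
      (𝓝 ((2 * Fintype.card I + 1) * K.cost + (|C| * 0 + 0))) :=
    tendsto_const_nhds.add ((hsq.const_mul _).add (tendsto_const_div_atTop_nhds_zero_nat _))
  have hfin : (N : ℝ) * L ≤ (2 * Fintype.card I + 1) * K.cost + (|C| * 0 + 0) := by
    refine le_of_tendsto_of_tendsto hlim1 hlim2 ?_
    filter_upwards [eventually_gt_atTop 0] with m hm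
    have hm' : (0 : ℝ) < m := by exact_mod_cast hm
    have hN' : (0 : ℝ) < N := by exact_mod_cast hN
    have h1 := hle m
    have e1 : (N : ℝ) * (condDist X Y U V (N * m) / (N * m : ℕ)) =
        condDist X Y U V (N * m) / m := by
      push_cast
      field_simp
    have e2 : (2 * Fintype.card I + 1) * K.cost + (|C| * (√(m : ℝ) / m) + (|C| + (C₁ + C₂)) / m) =
        ((2 * Fintype.card I + 1) * K.cost * m + (|C| * (√m + 1) + (C₁ + C₂))) / m := by
      field_simp
      ring
    rw [e1, e2]
    exact div_le_div_of_nonneg_right h1 hm'.le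
  have h6 := mul_lt_mul_of_pos_left hK (by positivity : (0 : ℝ) < 2 * Fintype.card I + 1)
  rw [mul_add, mul_div_cancel₀ _ (by positivity)] at h6
  linarith

end Scaling

end PartSpace

/-! ### From diagrams to partitioned spaces -/

open FinProbSpace

theorem pushWeight_eq_of_bijective {Ω Ω' : Type*} [Fintype Ω] {g : Ω → Ω'}
    (hg : Function.Bijective g) {p : Ω → ℝ} {p' : Ω' → ℝ} (h : ∀ x, p' (g x) = p x) :
    pushWeight g p = p' := by
  funext y
  obtain ⟨x, rfl⟩ := hg.2 y
  rw [h]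
  exact pushWeight_apply_equiv p (Equiv.ofBijective g hg) x

theorem PMF.ext_toReal {α : Type*} {p q : PMF α} (h : ∀ x, (p x).toReal = (q x).toReal) : p = q :=
  PMF.ext fun x => (ENNReal.toReal_eq_toReal_iff' (p.apply_ne_top x) (q.apply_ne_top x)).1 (h x)

namespace FinProbSpace

theorem weight_pos (X : FinProbSpace.{u}) (x : X.Atom) : 0 < X.weight x :=
  ENNReal.toReal_pos ((PMF.mem_support_iff _ _).1 x.2) (X.prob.apply_ne_top _)

theorem tsum_eq_sum_atom (X : FinProbSpace.{u}) {g : X.carrier → ENNReal}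
    (hg : ∀ x, X.prob x = 0 → g x = 0) : ∑' x, g x = ∑ x : X.Atom, g x.1 := by
  rw [← tsum_fintype (L := SummationFilter.unconditional _) (fun x : X.Atom => g x.1)]
  refine (tsum_subtype_eq_of_support_subset (s := X.prob.support) fun x hx => ?_).symm
  rw [PMF.mem_support_iff]
  exact fun h => hx (hg x h)

theorem toReal_map_apply (X : FinProbSpace.{u}) {β : Type*} (f : X.carrier → β) (y : β) :
    ((X.prob.map f) y).toReal = pushWeight (fun x : X.Atom => f x.1) X.weight y := by
  classical
  rw [PMF.map_apply, X.tsum_eq_sum_atom fun x hx => by simp [hx],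
    ENNReal.toReal_sum fun x _ => by split_ifs <;> simp [X.prob.apply_ne_top], pushWeight]
  refine Finset.sum_congr rfl fun x _ => ?_
  by_cases h : f x.1 = y
  · rw [if_pos h, if_pos h.symm]; rfl
  · rw [if_neg h, if_neg fun h' => h h'.symm]; rfl

theorem sum_weight (X : FinProbSpace.{u}) : ∑ x, X.weight x = 1 := by
  have h := X.tsum_eq_sum_atom (g := X.prob) fun _ h => h
  rw [PMF.tsum_coe] at h
  have h2 := congrArg ENNReal.toReal h
  rw [ENNReal.toReal_sum fun x _ => X.prob.apply_ne_top _] at h2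
  exact h2.symm.trans ENNReal.toReal_one

theorem IsReduction.mem_support {X Y : FinProbSpace.{u}} {f : X.carrier → Y.carrier}
    (hf : IsReduction X Y f) {x : X.carrier} (hx : x ∈ X.prob.support) :
    f x ∈ Y.prob.support := by
  rw [← show X.prob.map f = Y.prob from hf, PMF.mem_support_map_iff]
  exact ⟨x, hx, rfl⟩

/-- The map of atoms induced by a reduction. -/
def IsReduction.atomMap {X Y : FinProbSpace.{u}} {f : X.carrier → Y.carrier}
    (hf : IsReduction X Y f) (x : X.Atom) : Y.Atom :=
  ⟨f x.1, hf.mem_support x.2⟩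

theorem IsReduction.pushWeight_atomMap {X Y : FinProbSpace.{u}} {f : X.carrier → Y.carrier}
    (hf : IsReduction X Y f) : pushWeight hf.atomMap X.weight = Y.weight := by
  classical
  funext y
  refine Eq.trans ?_ ((X.toReal_map_apply f y.1).symm.trans
    (congrArg (fun q : PMF Y.carrier => (q y.1).toReal) hf))
  refine Finset.sum_congr rfl fun x _ => ?_
  by_cases h : f x.1 = y.1
  · rw [if_pos h, if_pos (Subtype.ext h)]
  · rw [if_neg h, if_neg fun h' => h (congrArg Subtype.val h')]

/-- The distribution with given real weights on a finite set. -/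
def realPMF {Ω : Type*} [Fintype Ω] (p : Ω → ℝ) (hp : ∀ ω, 0 ≤ p ω) (h1 : ∑ ω, p ω = 1) : PMF Ω :=
  PMF.ofFintype (fun ω => ENNReal.ofReal (p ω)) (by
    rw [← ENNReal.ofReal_sum_of_nonneg fun ω _ => hp ω, h1, ENNReal.ofReal_one])

theorem toReal_map_realPMF {Ω : Type*} [Fintype Ω] {p : Ω → ℝ} (hp : ∀ ω, 0 ≤ p ω)
    (h1 : ∑ ω, p ω = 1) {β : Type*} (f : Ω → β) (y : β) :
    (((realPMF p hp h1).map f) y).toReal = pushWeight f p y := by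
  classical
  rw [PMF.map_apply, tsum_fintype, ENNReal.toReal_sum fun x _ => by
    split_ifs <;> simp [(realPMF p hp h1).apply_ne_top], pushWeight]
  refine Finset.sum_congr rfl fun x _ => ?_
  by_cases h : f x = y
  · rw [if_pos h, if_pos h.symm]
    exact ENNReal.toReal_ofReal (hp x)
  · rw [if_neg h, if_neg fun h' => h h'.symm]; rfl

/-- The atoms of Z are the fibres of f of positive weight; the other fibres contribute nothing to
either side. -/
theorem entropy_eq_partEntropy {Ω : Type*} [Fintype Ω] {p : Ω → ℝ} (hp : ∀ ω, 0 ≤ p ω)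
    (Z : FinProbSpace.{u}) (f : Ω → Z.carrier)
    (h : ∀ z, (Z.prob z).toReal = pushWeight f p z) :
    Z.entropy = partEntropy p ((⊥ : Setoid Z.carrier).comap f) := by
  classical
  have hmem : ∀ ω, p ω ≠ 0 → f ω ∈ Z.prob.support := fun ω hω => by
    rw [PMF.mem_support_iff]
    intro h0
    have := h (f ω)
    rw [h0, ENNReal.toReal_zero] at this
    exact hω (pushWeight_eq_zero hp this.symm)
  have hcw : ∀ ω, classWeight p ((⊥ : Setoid Z.carrier).comap f) ω = pushWeight f p (f ω) :=
    fun ω => rfl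
  simp only [partEntropy, hcw]
  have h1 : ∀ z : Z.Atom, Real.negMulLog (Z.weight z) =
      -∑ ω, if f ω = z.1 then p ω * Real.log (pushWeight f p (f ω)) else 0 := fun z => by
    rw [Real.negMulLog, show Z.weight z = pushWeight f p z.1 from h z.1, neg_mul]
    conv_lhs => rw [pushWeight]
    rw [Finset.sum_mul]
    congr 1
    refine Finset.sum_congr rfl fun ω _ => ?_
    by_cases hω : f ω = z.1
    · rw [if_pos hω, if_pos hω, hω]; rfl
    · rw [if_neg hω, if_neg hω, zero_mul]
  rw [entropy, Finset.sum_congr rfl fun z _ => h1 z, Finset.sum_neg_distrib, Finset.sum_comm]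
  congr 1
  refine Finset.sum_congr rfl fun ω _ => ?_
  by_cases hω : p ω = 0
  · simp [hω]
  · rw [Finset.sum_eq_single (⟨f ω, hmem ω hω⟩ : Z.Atom)]
    · simp
    · intro z _ hz
      exact if_neg fun h' => hz (Subtype.ext h'.symm)
    · simp

end FinProbSpace

namespace ProbDiagram

section PartSpace

variable {G : Type v} [SemilatticeInf G] [Fintype G]

/-- The atoms of the initial space of a diagram, partitioned by the fibres of its maps. -/
def toPartSpace (X : ProbDiagram.{u} G) (ι : G) : PartSpace.{v, u} G where
  Ω := (X.obj (initialObj ι)).Atom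
  p := (X.obj (initialObj ι)).weight
  nonneg x := ((X.obj (initialObj ι)).weight_pos x).le
  sum_eq_one := (X.obj (initialObj ι)).sum_weight
  part i := (⊥ : Setoid (X.obj i).carrier).comap fun x => X.map (initialObj_le ι i) x.1

theorem ent_toPartSpace (X : ProbDiagram.{u} G) (ι i : G) :
    (X.toPartSpace ι).ent i = (X.obj i).entropy :=
  (entropy_eq_partEntropy (fun x => ((X.obj (initialObj ι)).weight_pos x).le) _ _ fun z => by
    rw [← toReal_map_apply, show (X.obj (initialObj ι)).prob.map _ = (X.obj i).prob from
      X.map_isReduction (initialObj_le ι i)]).symm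

variable {X Y : ProbDiagram.{u} G} {ι : G}

/-- The distribution of a coupling. -/
def couplingPMF (K : (X.toPartSpace ι).Coupling (Y.toPartSpace ι)) :
    PMF ((X.toPartSpace ι).Ω × (Y.toPartSpace ι).Ω) :=
  realPMF K.q K.nonneg K.sum_eq_one

/-- The pair of maps from the space of a coupling to the product of the `i`-th spaces. -/
def couplingMap (X Y : ProbDiagram.{u} G) (ι i : G)
    (z : (X.toPartSpace ι).Ω × (Y.toPartSpace ι).Ω) : (X.obj i).carrier × (Y.obj i).carrier :=
  (X.map (initialObj_le ι i) z.1.1, Y.map (initialObj_le ι i) z.2.1)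

theorem couplingMap_trans {i j : G} (h : i ≤ j)
    (z : (X.toPartSpace ι).Ω × (Y.toPartSpace ι).Ω) :
    Prod.map (X.map h) (Y.map h) (couplingMap X Y ι i z) = couplingMap X Y ι j z :=
  Prod.ext (X.map_trans _ h _ z.1.2) (Y.map_trans _ h _ z.2.2)

theorem mem_support_of_couplingMap {K : (X.toPartSpace ι).Coupling (Y.toPartSpace ι)} {i : G}
    {x : (X.obj i).carrier × (Y.obj i).carrier}
    (hx : x ∈ ((couplingPMF K).map (couplingMap X Y ι i)).support) :
    x.1 ∈ (X.obj i).prob.support ∧ x.2 ∈ (Y.obj i).prob.support := by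
  rw [PMF.mem_support_map_iff] at hx
  obtain ⟨z, -, rfl⟩ := hx
  exact ⟨(X.map_isReduction _).mem_support z.1.2, (Y.map_isReduction _).mem_support z.2.2⟩

/-- The fan defined by a coupling of the initial spaces. -/
def fanOfCoupling (K : (X.toPartSpace ι).Coupling (Y.toPartSpace ι)) : Fan X Y where
  apex :=
    { obj := fun i =>
        { carrier := (X.obj i).carrier × (Y.obj i).carrier
          prob := (couplingPMF K).map (couplingMap X Y ι i)
          finite_support :=
            (((X.obj i).finite_support.prod (Y.obj i).finite_support)).subset fun _ hx =>
              mem_support_of_couplingMap hx }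
      map := fun h => Prod.map (X.map h) (Y.map h)
      map_isReduction := fun {i j} h => by
        change ((couplingPMF K).map (couplingMap X Y ι i)).map _ =
          (couplingPMF K).map (couplingMap X Y ι j)
        rw [PMF.map_comp]
        congr 1
        exact funext fun z => couplingMap_trans h z
      map_refl := fun i x hx => Prod.ext (X.map_refl i _ (mem_support_of_couplingMap hx).1)
        (Y.map_refl i _ (mem_support_of_couplingMap hx).2)
      map_trans := fun hij hjk x hx =>
        Prod.ext (X.map_trans hij hjk _ (mem_support_of_couplingMap hx).1)
          (Y.map_trans hij hjk _ (mem_support_of_couplingMap hx).2) }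
  left :=
    { app := fun i => Prod.fst
      app_isReduction := fun i => by
        change ((couplingPMF K).map (couplingMap X Y ι i)).map _ = _
        rw [PMF.map_comp]
        refine PMF.ext_toReal fun x => ?_
        rw [couplingPMF, toReal_map_realPMF]
        rw [← show (X.obj (initialObj ι)).prob.map _ = (X.obj i).prob from
          X.map_isReduction (initialObj_le ι i), toReal_map_apply]
        rw [← show pushWeight Prod.fst K.q = (X.obj (initialObj ι)).weight from K.fst]
        exact congrFun (pushWeight_comp K.q Prod.fst
          fun a : (X.obj (initialObj ι)).Atom => X.map (initialObj_le ι i) a.1).symm x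
      naturality := fun _ _ _ => rfl }
  right :=
    { app := fun i => Prod.snd
      app_isReduction := fun i => by
        change ((couplingPMF K).map (couplingMap X Y ι i)).map _ = _
        rw [PMF.map_comp]
        refine PMF.ext_toReal fun x => ?_
        rw [couplingPMF, toReal_map_realPMF]
        rw [← show (Y.obj (initialObj ι)).prob.map _ = (Y.obj i).prob from
          Y.map_isReduction (initialObj_le ι i), toReal_map_apply]
        rw [← show pushWeight Prod.snd K.q = (Y.obj (initialObj ι)).weight from K.snd]
        exact congrFun (pushWeight_comp K.q Prod.snd
          fun a : (Y.obj (initialObj ι)).Atom => Y.map (initialObj_le ι i) a.1).symm x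
      naturality := fun _ _ _ => rfl }

theorem entropy_fanOfCoupling (K : (X.toPartSpace ι).Coupling (Y.toPartSpace ι)) (i : G) :
    ((fanOfCoupling K).apex.obj i).entropy = partEntropy K.q (K.joint i) := by
  rw [entropy_eq_partEntropy K.nonneg _ (couplingMap X Y ι i) fun z =>
    toReal_map_realPMF K.nonneg K.sum_eq_one _ _]
  congr 1
  ext z z'
  exact ⟨fun h => ⟨congrArg Prod.fst h, congrArg Prod.snd h⟩, fun h => Prod.ext h.1 h.2⟩

/-- The apex has at least the entropy of either end, so the absolute values can be dropped. -/
theorem kd_fanOfCoupling (K : (X.toPartSpace ι).Coupling (Y.toPartSpace ι)) :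
    kd (fanOfCoupling K) = K.cost := by
  rw [kd, PartSpace.Coupling.cost, ← Finset.sum_add_distrib]
  refine Finset.sum_congr rfl fun i _ => ?_
  have h1 := K.ent_fst_le i
  have h2 := K.ent_snd_le i
  rw [ent_toPartSpace] at h1 h2
  rw [entropy_fanOfCoupling, ent_toPartSpace, ent_toPartSpace, abs_of_nonneg (by linarith),
    abs_of_nonneg (by linarith)]
  ring

/-- A fan couples the initial spaces through the initial space of its apex. By naturality, two
points identified in the i-th space of the apex are identified in both ends, so the joint entropy is
at most that of the apex. -/
theorem dist_toPartSpace_le_kd (ι : G) (F : Fan X Y) :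
    PartSpace.dist (X.toPartSpace ι) (Y.toPartSpace ι) ≤ kd F := by
  refine (PartSpace.dist_le_of_span (X := X.toPartSpace ι) (Y := Y.toPartSpace ι)
    (L := (F.apex.toPartSpace ι).Ω)
    (F.apex.toPartSpace ι).p (F.apex.toPartSpace ι).nonneg
    (F.left.app_isReduction (initialObj ι)).atomMap
    (F.right.app_isReduction (initialObj ι)).atomMap
    (F.left.app_isReduction (initialObj ι)).pushWeight_atomMap
    (F.right.app_isReduction (initialObj ι)).pushWeight_atomMap).trans ?_
  rw [kd, ← Finset.sum_add_distrib]
  refine Finset.sum_le_sum fun i _ => ?_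
  have h : (F.apex.toPartSpace ι).part i ≤
      ((X.toPartSpace ι).part i).comap (F.left.app_isReduction (initialObj ι)).atomMap ⊓
      ((Y.toPartSpace ι).part i).comap (F.right.app_isReduction (initialObj ι)).atomMap := by
    intro z z' hz
    refine ⟨?_, ?_⟩
    · change X.map _ (F.left.app _ z.1) = X.map _ (F.left.app _ z'.1)
      rw [← F.left.naturality _ _ z.2, ← F.left.naturality _ _ z'.2]
      exact congrArg _ hz
    · change Y.map _ (F.right.app _ z.1) = Y.map _ (F.right.app _ z'.1)
      rw [← F.right.naturality _ _ z.2, ← F.right.naturality _ _ z'.2]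
      exact congrArg _ hz
  have h1 := partEntropy_mono (F.apex.toPartSpace ι).nonneg h
  have h2 := F.apex.ent_toPartSpace ι i
  rw [PartSpace.ent] at h2
  rw [h2] at h1
  rw [ent_toPartSpace, ent_toPartSpace]
  refine (sub_le_sub_right (sub_le_sub_right (mul_le_mul_of_nonneg_left h1 zero_le_two) _) _).trans
    ?_
  linarith [le_abs_self ((F.apex.obj i).entropy - (X.obj i).entropy),
    le_abs_self ((F.apex.obj i).entropy - (Y.obj i).entropy)]

theorem ikd_eq_dist (X Y : ProbDiagram.{u} G) (ι : G) :
    ikd X Y = PartSpace.dist (X.toPartSpace ι) (Y.toPartSpace ι) := by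
  have : Nonempty (Fan X Y) := ⟨fanOfCoupling (ι := ι) (Classical.arbitrary _)⟩
  refine le_antisymm (le_ciInf fun K => ?_) (le_ciInf fun F => dist_toPartSpace_le_kd ι F)
  rw [← kd_fanOfCoupling]
  refine ciInf_le ⟨0, ?_⟩ _
  rintro _ ⟨F, rfl⟩
  exact (PartSpace.dist_nonneg _ _).trans (dist_toPartSpace_le_kd ι F)

end PartSpace

end ProbDiagram

theorem prodPMF_apply {α β : Type u} (p : PMF α) (q : PMF β) (x : α) (y : β) :
    FinProbSpace.prodPMF p q (x, y) = p x * q y := by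
  classical
  rw [FinProbSpace.prodPMF, PMF.bind_apply, tsum_eq_single x, PMF.map_apply, tsum_eq_single y]
  · simp
  · intro y' hy'
    exact if_neg fun h => hy' (congrArg Prod.snd h).symm
  · intro x' hx'
    rw [PMF.map_apply]
    exact mul_eq_zero_of_right _ (ENNReal.tsum_eq_zero.2 fun y' =>
      if_neg fun h => hx' (congrArg Prod.fst h).symm)

theorem mk_mem_support_prodPMF {α β : Type u} {p : PMF α} {q : PMF β} {x : α} {y : β}
    (hx : x ∈ p.support) (hy : y ∈ q.support) : (x, y) ∈ (FinProbSpace.prodPMF p q).support := by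
  rw [PMF.mem_support_iff, prodPMF_apply]
  exact mul_ne_zero ((PMF.mem_support_iff _ _).1 hx) ((PMF.mem_support_iff _ _).1 hy)

/-! ### Conditioned diagrams and the conclusion -/

namespace ProbDiagram

section PartSpace

variable {G : Type v} [SemilatticeInf G] [Fintype G]

open PartSpace (dist powers)

theorem dist_toPartSpace_tensorFamily {K : Type w} [Fintype K] (X : K → ProbDiagram.{u} G)
    (ι : G) : dist ((tensorFamily X).toPartSpace ι)
      (PartSpace.pi fun k => (X k).toPartSpace ι) = 0 := by
  classical
  refine PartSpace.dist_eq_zero_of_map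
    (fun x k => ⟨x.1 k, mem_support_tensorFamily x.2 k⟩) ?_ fun i => ?_
  · refine pushWeight_eq_of_bijective ⟨fun x y h => ?_, fun y => ?_⟩ fun x => ?_
    · exact Subtype.ext (funext fun k => congrArg Subtype.val (congrFun h k))
    · exact ⟨⟨fun k => (y k).1, (PMF.mem_support_iff _ _).2 (Finset.prod_ne_zero_iff.2
        fun k _ => (PMF.mem_support_iff _ _).1 (y k).2)⟩, rfl⟩
    · exact (ENNReal.toReal_prod _ _).symm
  · ext x y
    exact ⟨fun h k => congrFun h k, fun h => funext h⟩

theorem dist_toPartSpace_pow (X : ProbDiagram.{u} G) (ι : G) (n : ℕ) :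
    dist ((X.pow n).toPartSpace ι) (PartSpace.pi fun _ : Fin n => X.toPartSpace ι) = 0 :=
  dist_toPartSpace_tensorFamily (fun _ : Fin n => X) ι

theorem dist_toPartSpace_tensor (X Y : ProbDiagram.{u} G) (ι : G) :
    dist ((X.tensor Y).toPartSpace ι)
      (PartSpace.pi fun b : Bool => bif b then X.toPartSpace ι else Y.toPartSpace ι) = 0 := by
  classical
  let g (x : ((X.tensor Y).toPartSpace ι).Ω) :
      ∀ b : Bool, (bif b then X.toPartSpace ι else Y.toPartSpace ι).Ω
    | true => (⟨x.1.1, (mem_support_prodPMF x.2).1⟩ : (X.obj (initialObj ι)).Atom)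
    | false => (⟨x.1.2, (mem_support_prodPMF x.2).2⟩ : (Y.obj (initialObj ι)).Atom)
  refine PartSpace.dist_eq_zero_of_map g ?_ fun i => ?_
  · refine pushWeight_eq_of_bijective ⟨fun x y h => ?_, fun y => ?_⟩ fun x => ?_
    · exact Subtype.ext (Prod.ext (congrArg Subtype.val (congrFun h true))
        (congrArg Subtype.val (congrFun h false)))
    · refine ⟨⟨((y true).1, (y false).1), mk_mem_support_prodPMF (y true).2 (y false).2⟩, ?_⟩
      funext b
      cases b <;> rfl
    · refine (Fintype.prod_bool fun b =>
        (bif b then X.toPartSpace ι else Y.toPartSpace ι).p (g x b)).trans ?_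
      refine Eq.trans ?_ (congrArg ENNReal.toReal (prodPMF_apply _ _ x.1.1 x.1.2)).symm
      exact ENNReal.toReal_mul.symm
  · ext x y
    constructor
    · intro h b
      cases b
      · exact congrArg Prod.snd h
      · exact congrArg Prod.fst h
    · exact fun h => Prod.ext (h true) (h false)

/-- The map from the atoms of the initial space to the atoms of `X_ι`. -/
def toAtom (X : ProbDiagram.{u} G) (ι : G) : (X.toPartSpace ι).Ω → (X.obj ι).Atom :=
  (X.map_isReduction (initialObj_le ι ι)).atomMap

theorem pushWeight_toAtom (X : ProbDiagram.{u} G) (ι : G) :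
    pushWeight (X.toAtom ι) (X.toPartSpace ι).p = (X.obj ι).weight :=
  (X.map_isReduction (initialObj_le ι ι)).pushWeight_atomMap

theorem part_toPartSpace_eq_comap (X : ProbDiagram.{u} G) (ι : G) :
    (X.toPartSpace ι).part ι = (⊥ : Setoid (X.obj ι).Atom).comap (X.toAtom ι) := by
  ext x y
  exact ⟨fun h => Subtype.ext h, fun h => congrArg Subtype.val h⟩

theorem toReal_condInitial (X : ProbDiagram.{u} G) (ι : G) (a : (X.obj ι).Atom)
    (x : (X.toPartSpace ι).Ω) :
    (X.condInitial ι a x.1).toReal = condWeight (X.toPartSpace ι).p (X.toAtom ι) a x := by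
  classical
  have hsum : ∑' y, (X.map (initialObj_le ι ι) ⁻¹' {a.1}).indicator
      (X.obj (initialObj ι)).prob y = (X.obj ι).prob a.1 := by
    refine Eq.trans ?_ (congrArg (fun q : PMF (X.obj ι).carrier => q a.1)
      (X.map_isReduction (initialObj_le ι ι)))
    refine Eq.trans (tsum_congr fun y => ?_) (PMF.map_apply _ _ _).symm
    rw [Set.indicator_apply]
    exact if_congr ⟨fun h => Eq.symm h, fun h => Eq.symm h⟩ rfl rfl
  have hpos := (X.obj ι).weight_pos a
  rw [condInitial, PMF.filter_apply, hsum, condWeight, pushWeight_toAtom, if_neg hpos.ne',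
    ENNReal.toReal_mul, ENNReal.toReal_inv, Set.indicator_apply]
  by_cases h : X.toAtom ι x = a
  · have hx : x.1 ∈ X.map (initialObj_le ι ι) ⁻¹' {a.1} := congrArg Subtype.val h
    rw [if_pos h, if_pos hx]
    exact (div_eq_mul_inv _ _).symm
  · have hx : x.1 ∉ X.map (initialObj_le ι ι) ⁻¹' {a.1} := fun h' => h (Subtype.ext h')
    rw [if_neg h, if_neg hx, ENNReal.toReal_zero, zero_mul]

/-- The conditioned diagram has as initial atoms only those over a, whereas the conditioned
partitioned space keeps all points, some with weight zero; the inclusion identifies the two. -/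
theorem dist_toPartSpace_cond (X : ProbDiagram.{u} G) (ι : G) (a : (X.obj ι).Atom) :
    dist ((X.cond ι a).toPartSpace ι) ((X.toPartSpace ι).cond (X.toAtom ι) a) = 0 := by
  classical
  refine PartSpace.dist_eq_zero_of_map
    (fun x => (⟨x.1, X.cond_support ι a _ x.2⟩ : (X.obj (initialObj ι)).Atom)) ?_ fun i => rfl
  -- The structure map of the initial object to itself is the identity on atoms only, which suffices
  -- for push-forwards.
  have hid : (X.condInitial ι a).map (X.map (initialObj_le ι (initialObj ι))) =
      X.condInitial ι a := by
    refine PMF.ext fun y => ?_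
    rw [PMF.map_apply, tsum_eq_single y]
    · by_cases hy : X.condInitial ι a y = 0
      · simp [hy]
      · rw [X.map_refl _ y (X.condInitial_support ι a hy), if_pos rfl]
    · intro z hz
      by_cases hz0 : X.condInitial ι a z = 0
      · simp [hz0]
      · rw [X.map_refl _ z (X.condInitial_support ι a hz0), if_neg hz.symm]
  refine funext fun (y : (X.obj (initialObj ι)).Atom) => ?_
  refine Eq.trans ?_ (X.toReal_condInitial ι a y)
  rw [← hid]
  have h := toReal_map_apply ((X.cond ι a).obj (initialObj ι)) id y.1
  rw [PMF.map_id] at h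
  refine Eq.trans ?_ h.symm
  refine Finset.sum_congr rfl fun x _ => ?_
  by_cases hx : x.1 = y.1
  · exact (if_pos (Subtype.ext hx)).trans (if_pos hx).symm
  · exact (if_neg fun h' => hx (congrArg Subtype.val h')).trans (if_neg hx).symm

theorem dist_toPartSpace_condSeq (X : ProbDiagram.{u} G) (ι : G) (n : ℕ) :
    dist ((X.condSeq ι n).toPartSpace ι) (powers ((X.toPartSpace ι).cond (X.toAtom ι))
      fun a => ⌊pushWeight (X.toAtom ι) (X.toPartSpace ι).p a * n⌋₊) = 0 := by
  rw [pushWeight_toAtom]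
  have h1 := dist_toPartSpace_tensorFamily
    (fun a : (X.obj ι).Atom => (X.cond ι a).pow ⌊(X.obj ι).weight a * n⌋₊) ι
  have h2 : dist (PartSpace.pi fun a : (X.obj ι).Atom =>
      ((X.cond ι a).pow ⌊(X.obj ι).weight a * n⌋₊).toPartSpace ι)
      (PartSpace.pi fun a : (X.obj ι).Atom => PartSpace.pi
        fun _ : Fin ⌊(X.obj ι).weight a * n⌋₊ => (X.toPartSpace ι).cond (X.toAtom ι) a) = 0 :=
    PartSpace.dist_pi_eq_zero fun a => by
      rw [PartSpace.dist_congr_left (dist_toPartSpace_pow _ _ _)]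
      exact PartSpace.dist_pi_eq_zero fun _ => X.dist_toPartSpace_cond ι a
  have h3 := PartSpace.dist_pi_sigma fun (a : (X.obj ι).Atom)
    (_ : Fin ⌊(X.obj ι).weight a * n⌋₊) => (X.toPartSpace ι).cond (X.toAtom ι) a
  exact (PartSpace.dist_congr_left h1 _).trans ((PartSpace.dist_congr_left h2 _).trans h3)

theorem ikd_condSeq (X Y : ProbDiagram.{u} G) (ι : G) (n : ℕ) :
    ikd (X.condSeq ι n) (Y.condSeq ι n) = PartSpace.condDist (X.toPartSpace ι) (Y.toPartSpace ι)
      (X.toAtom ι) (Y.toAtom ι) n := by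
  rw [ikd_eq_dist _ _ ι, PartSpace.dist_congr (X.dist_toPartSpace_condSeq ι n)
    (Y.dist_toPartSpace_condSeq ι n), PartSpace.condDist]

theorem ikd_pow (X Y : ProbDiagram.{u} G) (ι : G) (n : ℕ) :
    ikd (X.pow n) (Y.pow n) = dist (PartSpace.pi fun _ : Fin n => X.toPartSpace ι)
      (PartSpace.pi fun _ : Fin n => Y.toPartSpace ι) := by
  rw [ikd_eq_dist _ _ ι, PartSpace.dist_congr (X.dist_toPartSpace_pow ι n)
    (Y.dist_toPartSpace_pow ι n)]

theorem ikd_nonneg (ι : G) (X Y : ProbDiagram.{u} G) : 0 ≤ ikd X Y := by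
  rw [ikd_eq_dist _ _ ι]
  exact PartSpace.dist_nonneg _ _

theorem ikd_self (ι : G) (X : ProbDiagram.{u} G) : ikd X X = 0 := by
  rw [ikd_eq_dist _ _ ι, PartSpace.dist_self]

theorem ikd_pow_le (ι : G) (X Y : ProbDiagram.{u} G) (n : ℕ) :
    ikd (X.pow n) (Y.pow n) ≤ n * ikd X Y := by
  rw [ikd_pow X Y ι, ikd_eq_dist _ _ ι]
  exact (PartSpace.dist_pi_le _ _).trans (le_of_eq (by simp))

theorem ikd_pow_eq_dist_powers (X Y : ProbDiagram.{u} G) (ι : G) (n : ℕ) :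
    ikd (X.pow n) (Y.pow n) = dist (powers (fun _ : Unit => X.toPartSpace ι) fun _ => n)
      (powers (fun _ : Unit => Y.toPartSpace ι) fun _ => n) := by
  rw [ikd_pow X Y ι]
  have h := fun Z : ProbDiagram.{u} G =>
    PartSpace.dist_pi_comp_powers (fun _ : Unit => Z.toPartSpace ι) fun _ : Fin n => ()
  simp only [Finset.filter_true, Finset.card_univ, Fintype.card_fin] at h
  exact PartSpace.dist_congr (h X) (h Y)

theorem tendsto_aikd (ι : G) (X Y : ProbDiagram.{u} G) :
    Tendsto (fun n : ℕ => ikd (X.pow n) (Y.pow n) / n) atTop (𝓝 (aikd X Y)) := by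
  -- `aikd` is a `limUnder`, so it has the expected meaning only once convergence is known.
  obtain ⟨L, hL⟩ := exists_tendsto_div_of_almost_subadditive
    (s := fun n => ikd (X.pow n) (Y.pow n)) (fun n => ikd_nonneg ι _ _) (C := 0) fun n m => by
      simp only [ikd_pow_eq_dist_powers X Y ι, add_zero]
      exact PartSpace.dist_powers_add_le _ _ (fun _ => n) (fun _ => m) (fun _ => n) fun _ => m
  have : aikd X Y = L := hL.limUnder_eq
  rwa [this]

theorem aikd_le_ikd (ι : G) (X Y : ProbDiagram.{u} G) : aikd X Y ≤ ikd X Y := by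
  refine le_of_tendsto (tendsto_aikd ι X Y) ?_
  filter_upwards [eventually_gt_atTop 0] with n hn
  rw [div_le_iff₀ (by exact_mod_cast hn), mul_comm]
  exact ikd_pow_le ι X Y n

/-- The rounding defect is bounded by a constant C, and C ≤ (C / φ 1) * φ (n + m) because φ is
positive and nondecreasing. -/
theorem isQuasiLinear_condSeq {φ : ℝ → ℝ} (hφ : IsAdmissible φ) (hφpos : ∀ t, 1 ≤ t → 0 < φ t)
    (X : ProbDiagram.{u} G) (ι : G) : IsQuasiLinear φ (X.condSeq ι) := by
  set C := ∑ a, ((X.toPartSpace ι).cond (X.toAtom ι) a).totalEnt with hC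
  have hC0 : 0 ≤ C := Finset.sum_nonneg fun a _ => PartSpace.totalEnt_nonneg _
  refine ⟨C / φ 1, fun n m hnm => ?_⟩
  have h1 : (1 : ℝ) ≤ (n + m : ℕ) := by exact_mod_cast hnm
  have hφ1 := hφpos 1 le_rfl
  have hmono : φ 1 ≤ φ ((n + m : ℕ) : ℝ) := hφ.mono (Set.mem_Ici.2 le_rfl) (Set.mem_Ici.2 h1) h1
  have hle : ikd (X.condSeq ι (n + m)) ((X.condSeq ι n).tensor (X.condSeq ι m)) ≤ C := by
    have h2 := (PartSpace.dist_powers_floor_add_le ((X.toPartSpace ι).cond (X.toAtom ι))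
      (pushWeight_nonneg (X.toPartSpace ι).nonneg (X.toAtom ι)) n m)
    have h3 := PartSpace.dist_pi_powers ((X.toPartSpace ι).cond (X.toAtom ι)) fun b : Bool =>
      bif b then (fun a => ⌊pushWeight (X.toAtom ι) (X.toPartSpace ι).p a * n⌋₊)
        else fun a => ⌊pushWeight (X.toAtom ι) (X.toPartSpace ι).p a * m⌋₊
    have h4 := dist_toPartSpace_tensor (X.condSeq ι n) (X.condSeq ι m) ι
    have h5 : dist (PartSpace.pi fun b : Bool => bif b then (X.condSeq ι n).toPartSpace ι
        else (X.condSeq ι m).toPartSpace ι) (PartSpace.pi fun b : Bool =>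
        powers ((X.toPartSpace ι).cond (X.toAtom ι))
          (bif b then (fun a => ⌊pushWeight (X.toAtom ι) (X.toPartSpace ι).p a * n⌋₊)
        else fun a => ⌊pushWeight (X.toAtom ι) (X.toPartSpace ι).p a * m⌋₊)) = 0 :=
      PartSpace.dist_pi_eq_zero fun b => by
        cases b
        · exact X.dist_toPartSpace_condSeq ι m
        · exact X.dist_toPartSpace_condSeq ι n
    have h6 := (PartSpace.dist_congr_left h4 _).trans ((PartSpace.dist_congr_left h5 _).trans h3)
    have h7 : (fun a => ∑ b : Bool,
        (bif b then (fun a => ⌊pushWeight (X.toAtom ι) (X.toPartSpace ι).p a * n⌋₊)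
        else fun a => ⌊pushWeight (X.toAtom ι) (X.toPartSpace ι).p a * m⌋₊) a) =
        (fun a => ⌊pushWeight (X.toAtom ι) (X.toPartSpace ι).p a * n⌋₊) +
          fun a => ⌊pushWeight (X.toAtom ι) (X.toPartSpace ι).p a * m⌋₊ :=
      funext fun a => Fintype.sum_bool _
    rw [h7] at h6
    rw [ikd_eq_dist _ _ ι, PartSpace.dist_congr (X.dist_toPartSpace_condSeq ι (n + m)) h6]
    exact h2
  calc aikd _ _ ≤ C := (aikd_le_ikd ι _ _).trans hle
    _ = C / φ 1 * φ 1 := by field_simp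
    _ ≤ _ := mul_le_mul_of_nonneg_left hmono (div_nonneg hC0 hφ1.le)

theorem abs_ikd_sub_ikd_le (ι : G) (X X' Y Y' : ProbDiagram.{u} G) :
    |ikd X Y - ikd X' Y'| ≤ ikd X X' + ikd Y Y' := by
  simp only [ikd_eq_dist _ _ ι]
  exact PartSpace.abs_dist_sub_dist_le _ _ _ _

theorem tendsto_aikdSeq_condSeq (X Y : ProbDiagram.{u} G) (ι : G) :
    Tendsto (fun n : ℕ => ikd (X.condSeq ι n) (Y.condSeq ι n) / n) atTop
      (𝓝 (aikdSeq (X.condSeq ι) (Y.condSeq ι))) := by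
  obtain ⟨L, hL⟩ := PartSpace.exists_tendsto_condDist (X := X.toPartSpace ι)
    (Y := Y.toPartSpace ι) (X.toAtom ι) (Y.toAtom ι)
  simp only [← ikd_condSeq] at hL
  have : aikdSeq (X.condSeq ι) (Y.condSeq ι) = L := hL.limUnder_eq
  rwa [this]

/-- Independence of representatives: `ikd` is 1-Lipschitz in each argument, so equivalent sequences
change it by o(n). -/
theorem tendsto_of_asympEquiv (ι : G) {A A' B B' : ℕ → ProbDiagram.{u} G} (hA : AsympEquiv A A')
    (hB : AsympEquiv B B') {L : ℝ}
    (h : Tendsto (fun n : ℕ => ikd (A n) (B n) / n) atTop (𝓝 L)) :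
    Tendsto (fun n : ℕ => ikd (A' n) (B' n) / n) atTop (𝓝 L) := by
  have h0 : Tendsto (fun n : ℕ => ikd (A' n) (B' n) / n - ikd (A n) (B n) / n) atTop (𝓝 0) := by
    refine squeeze_zero_norm (fun n => ?_) (by simpa using hA.add hB)
    rw [← sub_div, Real.norm_eq_abs, abs_div, Nat.abs_cast, ← add_div, abs_sub_comm]
    exact div_le_div_of_nonneg_right (abs_ikd_sub_ikd_le ι _ _ _ _) (Nat.cast_nonneg n)
  simpa using h0.add h

theorem aikdSeq_condSeq_le (X Y : ProbDiagram.{u} G) (ι : G) :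
    aikdSeq (X.condSeq ι) (Y.condSeq ι) ≤ (2 * Fintype.card G + 1) * aikd X Y := by
  have hL := tendsto_aikdSeq_condSeq X Y ι
  simp only [ikd_condSeq] at hL
  refine ge_of_tendsto ((tendsto_aikd ι X Y).const_mul _) ?_
  filter_upwards [eventually_gt_atTop 0] with N hN
  have h := PartSpace.mul_lim_condDist_le (X := X.toPartSpace ι) (Y := Y.toPartSpace ι) ι
    (X.part_toPartSpace_eq_comap ι) (Y.part_toPartSpace_eq_comap ι)
    (fun a => by rw [pushWeight_toAtom]; exact (X.obj ι).weight_pos a)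
    (fun a => by rw [pushWeight_toAtom]; exact (Y.obj ι).weight_pos a) hL hN
  rw [← ikd_pow] at h
  rw [mul_div_assoc', le_div_iff₀ (by exact_mod_cast hN), mul_comm]
  exact h

theorem condSeq_mem_condTropical {φ : ℝ → ℝ} (hφ : IsAdmissible φ)
    (hφpos : ∀ t, 1 ≤ t → 0 < φ t) (X : ProbDiagram.{u} G) (ι : G) :
    X.condSeq ι ∈ X.condTropical φ ι := by
  refine ⟨isQuasiLinear_condSeq hφ hφpos X ι, ?_⟩
  simp [AsympEquiv, ikd_self ι]

end PartSpace

end ProbDiagram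

end

theorem corollaryp {G : Type v} [SemilatticeInf G] [Fintype G]
    (φ : ℝ → ℝ) (hφ : IsAdmissible φ) (hφpos : ∀ t, 1 ≤ t → 0 < φ t)
    (X Y : ProbDiagram.{u} G) (ι : G) :
    X.condSeq ι ∈ X.condTropical φ ι ∧ Y.condSeq ι ∈ Y.condTropical φ ι ∧
    Tendsto (fun n : ℕ => ProbDiagram.ikd (X.pow n) (Y.pow n) / n) atTop
      (𝓝 (ProbDiagram.aikd X Y)) ∧
    (∀ A ∈ X.condTropical φ ι, ∀ B ∈ Y.condTropical φ ι,
      Tendsto (fun n : ℕ => ProbDiagram.ikd (A n) (B n) / n) atTop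
        (𝓝 (ProbDiagram.aikdSeq (X.condSeq ι) (Y.condSeq ι)))) ∧
    ProbDiagram.aikdSeq (X.condSeq ι) (Y.condSeq ι) ≤
      (2 * Fintype.card G + 1) * ProbDiagram.aikd X Y := by
  exact ⟨X.condSeq_mem_condTropical hφ hφpos ι, Y.condSeq_mem_condTropical hφ hφpos ι,
    ProbDiagram.tendsto_aikd ι X Y,
    fun A hA B hB => ProbDiagram.tendsto_of_asympEquiv ι hA.2 hB.2
      (ProbDiagram.tendsto_aikdSeq_condSeq X Y ι),
    ProbDiagram.aikdSeq_condSeq_le X Y ι⟩
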